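/- Let $K$ be a field and let $E$ and $F$ be finite directed graphs (finitely many vertices and edges) with no sinks, i.e. every vertex emits at least one edge. Let $A_E$ and $A_F$ be their adjacency matrices, where the $(v,w)$ entry is the number of edges from $v$ to $w$. Let $\mathcal L_K(E)$ be the Leavitt path algebra of $E$: the $K$-algebra generated by the vertices $v$, the edges $\alpha$ and the ghost edges $\alpha^*$, subject to $vw=\delta_{v,w}v$ for vertices $v,w$; $s(\alpha)\alpha=\alpha r(\alpha)=\alpha$ and $r(\alpha)\alpha^*=\alpha^*s(\alpha)=\alpha^*$; $\alpha^*\beta=\delta_{\alpha,\beta}\,r(\alpha)$ for edges $\alpha,\beta$; and $\sum_{s(\alpha)=v}\alpha\alpha^*=v$ for every vertex $v$ that emits an edge. Its identity is $\sum_v v$, and it is $\mathbb Z$-graded by $\deg v=0$, $\deg\alpha=1$, $\deg\alpha^*=-1$. For a $\mathbb Z$-graded ring $A$ let $K_0^{\mathrm{gr}}(A)$ be the group completion of the monoid $\mathcal V^{\mathrm{gr}}(A)$ of graded isomorphism classes of $\mathbb Z$-graded finitely generated projective right $A$-modules under direct sum. It is a $\mathbb Z[x,x^{-1}]$-module via $x^k[P]=[P(k)]$,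 where $P(k)_i=P_{k+i}$, and it is pre-ordered with positive cone the image of $\mathcal V^{\mathrm{gr}}(A)$. Two square nonnegative integer matrices $A$ and $B$ are shift equivalent if there are an integer $l\ge 1$ and nonnegative integer matrices $R$ and $S$ with $A^l=RS$, $B^l=SR$, $AR=RB$ and $SA=BS$. Then $A_E$ and $A_F$ are shift equivalent if and only if there is a $\mathbb Z[x,x^{-1}]$-module isomorphism $\varphi: K_0^{\mathrm{gr}}(\mathcal L_K(E))\to K_0^{\mathrm{gr}}(\mathcal L_K(F))$ that is an isomorphism of pre-ordered groups, i.e. $\varphi(a)\le\varphi(b)$ if and only if $a\le b$ for all $a,b$ (equivalently, $\varphi$ maps the positive cone onto the positive cone). -/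

import Mathlib

open scoped DirectSum LaurentPolynomial
open MulOpposite (op)

universe u v w

/-! ### Shift equivalence of nonnegative integer matrices -/

/-- Two square nonnegative integer matrices `A` and `B` are shift equivalent if for some `l ≥ 1`
there are nonnegative integer matrices `R`, `S` with `A ^ l = R S`, `B ^ l = S R`, `A R = R B`
and `S A = B S`. -/
def Matrix.ShiftEquivalent {m : Type*} {n : Type*} [Fintype m] [DecidableEq m] [Fintype n]
    [DecidableEq n] (A : Matrix m m ℕ) (B : Matrix n n ℕ) : Prop :=
  ∃ (l : ℕ) (R : Matrix m n ℕ) (S : Matrix n m ℕ),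
    1 ≤ l ∧ A ^ l = R * S ∧ B ^ l = S * R ∧ A * R = R * B ∧ S * A = B * S

/-! ### Graded finitely generated projective modules and the graded Grothendieck group -/

section GradedK

variable {A : Type u} [Ring A] {σ : Type v} [SetLike σ A] (𝒜 : ℤ → σ)

/-- A `ℤ`-graded finitely generated projective right module over the ring `A` with graded
components `𝒜 i`. A right `A`-module is a module over `Aᵐᵒᵖ`. -/
structure GrProjModule where
  carrier : Type u
  [addCommGroup : AddCommGroup carrier]
  [module : Module Aᵐᵒᵖ carrier]
  component : ℤ → AddSubgroup carrier
  isInternal : DirectSum.IsInternal component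
  smul_mem : ∀ {i j : ℤ} {x : carrier} {a : A},
    x ∈ component i → a ∈ 𝒜 j → op a • x ∈ component (i + j)
  finite : Module.Finite Aᵐᵒᵖ carrier
  projective : Module.Projective Aᵐᵒᵖ carrier

namespace GrProjModule

attribute [instance] addCommGroup module finite projective

variable {𝒜}

/-- `P` and `Q` are graded isomorphic: there is a module isomorphism mapping each homogeneous
component of `P` into (equivalently, onto) the corresponding one of `Q`. -/
def GrIso (P Q : GrProjModule 𝒜) : Prop :=
  ∃ f : P.carrier ≃ₗ[Aᵐᵒᵖ] Q.carrier, ∀ (i : ℤ) (x : P.carrier),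
    f x ∈ Q.component i ↔ x ∈ P.component i

theorem isInternal_prod {M N : Type*} [AddCommGroup M] [AddCommGroup N]
    {p : ℤ → AddSubgroup M} {q : ℤ → AddSubgroup N} (hp : DirectSum.IsInternal p)
    (hq : DirectSum.IsInternal q) : DirectSum.IsInternal fun i => (p i).prod (q i) := by
  let fp : ∀ i, (p i).prod (q i) →+ p i := fun i =>
    ((AddMonoidHom.fst M N).comp ((p i).prod (q i)).subtype).codRestrict (p i) fun x => x.2.1
  let fq : ∀ i, (p i).prod (q i) →+ q i := fun i =>
    ((AddMonoidHom.snd M N).comp ((p i).prod (q i)).subtype).codRestrict (q i) fun x => x.2.2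
  let a : ∀ i, p i →+ (p i).prod (q i) := fun i =>
    ((AddMonoidHom.inl M N).comp (p i).subtype).codRestrict ((p i).prod (q i)) fun x =>
      ⟨x.2, (q i).zero_mem⟩
  let b : ∀ i, q i →+ (p i).prod (q i) := fun i =>
    ((AddMonoidHom.inr M N).comp (q i).subtype).codRestrict ((p i).prod (q i)) fun x =>
      ⟨(p i).zero_mem, x.2⟩
  let c := DirectSum.coeAddMonoidHom fun i => (p i).prod (q i)
  have ha : c.comp (DirectSum.map a) =
      (AddMonoidHom.inl M N).comp (DirectSum.coeAddMonoidHom p) := by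
    refine DirectSum.addHom_ext' fun i => AddMonoidHom.ext fun x => ?_
    simp only [c, AddMonoidHom.comp_apply, DirectSum.map_of, DirectSum.coeAddMonoidHom_of]
    rfl
  have hb : c.comp (DirectSum.map b) =
      (AddMonoidHom.inr M N).comp (DirectSum.coeAddMonoidHom q) := by
    refine DirectSum.addHom_ext' fun i => AddMonoidHom.ext fun x => ?_
    simp only [c, AddMonoidHom.comp_apply, DirectSum.map_of, DirectSum.coeAddMonoidHom_of]
    rfl
  have hfp : (AddMonoidHom.fst M N).comp c =
      (DirectSum.coeAddMonoidHom p).comp (DirectSum.map fp) := by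
    refine DirectSum.addHom_ext' fun i => AddMonoidHom.ext fun x => ?_
    simp only [c, AddMonoidHom.comp_apply, DirectSum.map_of, DirectSum.coeAddMonoidHom_of]
    rfl
  have hfq : (AddMonoidHom.snd M N).comp c =
      (DirectSum.coeAddMonoidHom q).comp (DirectSum.map fq) := by
    refine DirectSum.addHom_ext' fun i => AddMonoidHom.ext fun x => ?_
    simp only [c, AddMonoidHom.comp_apply, DirectSum.map_of, DirectSum.coeAddMonoidHom_of]
    rfl
  constructor
  · intro x y hxy
    have h1 : DirectSum.map fp x = DirectSum.map fp y := hp.1 <| by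
      have := congrArg Prod.fst (show c x = c y from hxy)
      exact (DFunLike.congr_fun hfp x).symm.trans (this.trans (DFunLike.congr_fun hfp y))
    have h2 : DirectSum.map fq x = DirectSum.map fq y := hq.1 <| by
      have := congrArg Prod.snd (show c x = c y from hxy)
      exact (DFunLike.congr_fun hfq x).symm.trans (this.trans (DFunLike.congr_fun hfq y))
    refine DFinsupp.ext fun i => Subtype.ext (Prod.ext ?_ ?_)
    · have := congrArg (fun z => ((z i : p i) : M)) h1
      simp only [DirectSum.map_apply] at this
      exact this
    · have := congrArg (fun z => ((z i : q i) : N)) h2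
      simp only [DirectSum.map_apply] at this
      exact this
  · rintro ⟨x, y⟩
    obtain ⟨x, rfl⟩ := hp.2 x
    obtain ⟨y, rfl⟩ := hq.2 y
    refine ⟨DirectSum.map a x + DirectSum.map b y, ?_⟩
    rw [map_add]
    refine (congrArg₂ (· + ·) (DFunLike.congr_fun ha x) (DFunLike.congr_fun hb y)).trans ?_
    exact Prod.ext (add_zero _) (zero_add _)

theorem isInternal_shift {M : Type*} [AddCommGroup M] {p : ℤ → AddSubgroup M}
    (hp : DirectSum.IsInternal p) (k : ℤ) : DirectSum.IsInternal fun i => p (k + i) := by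
  let e : (⨁ i, p i) ≃+ ⨁ i, p (k + i) :=
    DirectSum.equivCongrLeft (β := fun i => p i) (Equiv.addLeft k).symm
  have h : (DirectSum.coeAddMonoidHom fun i => p (k + i)).comp e.toAddMonoidHom =
      DirectSum.coeAddMonoidHom p := by
    refine DirectSum.addHom_ext' fun i => AddMonoidHom.ext fun x => ?_
    obtain ⟨j, rfl⟩ : ∃ j, i = k + j := ⟨-k + i, by ring⟩
    have he : e (DirectSum.of (fun i => p i) (k + j) x) =
        DirectSum.of (fun i => p (k + i)) j x := by
      refine DFinsupp.ext fun n => ?_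
      refine (DirectSum.equivCongrLeft_apply _ _ _).trans ?_
      by_cases hn : j = n
      · subst hn
        exact (DirectSum.of_eq_same (β := fun i => p i) (k + j) x).trans
          (DirectSum.of_eq_same (β := fun i => p (k + i)) j x).symm
      · have hn' : k + n ≠ k + j := fun h => hn (add_left_cancel h).symm
        exact (DirectSum.of_eq_of_ne (β := fun i => p i) (k + j) (k + n) x hn').trans
          (DirectSum.of_eq_of_ne (β := fun i => p (k + i)) j n x (Ne.symm hn)).symm
    simp only [AddMonoidHom.comp_apply, DirectSum.coeAddMonoidHom_of]
    refine (congrArg _ he).trans ?_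
    exact DirectSum.coeAddMonoidHom_of _ _ _
  have h' : Function.Bijective
      ((DirectSum.coeAddMonoidHom fun i => p (k + i)) ∘ e) := by
    have : (DirectSum.coeAddMonoidHom fun i => p (k + i)) ∘ e = DirectSum.coeAddMonoidHom p :=
      congrArg DFunLike.coe h
    rw [this]
    exact hp
  exact (Function.Bijective.of_comp_iff _ e.bijective).1 h'

/-- The direct sum `P ⊕ Q` of graded modules. -/
def prod (P Q : GrProjModule 𝒜) : GrProjModule 𝒜 where
  carrier := P.carrier × Q.carrier
  component i := (P.component i).prod (Q.component i)
  isInternal := isInternal_prod P.isInternal Q.isInternal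
  smul_mem hx ha := ⟨P.smul_mem hx.1 ha, Q.smul_mem hx.2 ha⟩
  finite := inferInstance
  projective := inferInstance

/-- The zero graded module. -/
def zero : GrProjModule 𝒜 where
  carrier := PUnit
  component _ := ⊤
  isInternal := by
    refine ⟨fun x y _ => DFinsupp.ext fun i => Subtype.ext rfl, fun y => ⟨?_, rfl⟩⟩
    exact DirectSum.of _ 0 0
  smul_mem _ _ := trivial
  finite := inferInstance
  projective := inferInstance

/-- The shifted (suspended) module `P(k)`, with `P(k)_i = P_{k + i}`. -/
def shift (k : ℤ) (P : GrProjModule 𝒜) : GrProjModule 𝒜 where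
  carrier := P.carrier
  component i := P.component (k + i)
  isInternal := isInternal_shift P.isInternal k
  smul_mem hx ha := add_assoc k _ _ ▸ P.smul_mem hx ha
  finite := P.finite
  projective := P.projective

variable (𝒜) in
/-- Graded isomorphism as an equivalence relation. -/
instance setoid : Setoid (GrProjModule 𝒜) where
  r := GrIso
  iseqv :=
    { refl := fun _ => ⟨LinearEquiv.refl _ _, fun _ _ => Iff.rfl⟩
      symm := fun ⟨f, hf⟩ => ⟨f.symm, fun i x => by simpa using (hf i (f.symm x)).symm⟩
      trans := fun ⟨f, hf⟩ ⟨g, hg⟩ => ⟨f.trans g, fun i x => (hg i (f x)).trans (hf i x)⟩ }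

end GrProjModule

/-- The monoid `V^gr(A)` of graded isomorphism classes of graded finitely generated projective
right `A`-modules. -/
def Vgr : Type (u + 1) := Quotient (GrProjModule.setoid 𝒜)

namespace Vgr

variable {𝒜}

/-- The class `[P]`. -/
def mk (P : GrProjModule 𝒜) : Vgr 𝒜 := Quotient.mk _ P

instance : Zero (Vgr 𝒜) := ⟨mk GrProjModule.zero⟩

/-- Addition is given by direct sum: `[P] + [Q] = [P ⊕ Q]`. -/
instance : Add (Vgr 𝒜) where
  add := Quotient.map₂ GrProjModule.prod fun _ _ ⟨f, hf⟩ _ _ ⟨g, hg⟩ =>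
    ⟨f.prodCongr g, fun i x => and_congr (hf i x.1) (hg i x.2)⟩

instance : AddCommMonoid (Vgr 𝒜) where
  nsmul := nsmulRec
  add_assoc := by
    rintro ⟨P⟩ ⟨Q⟩ ⟨R⟩
    exact Quotient.sound ⟨LinearEquiv.prodAssoc Aᵐᵒᵖ P.carrier Q.carrier R.carrier,
      fun _ _ => and_assoc.symm⟩
  zero_add := by
    rintro ⟨P⟩
    exact Quotient.sound ⟨LinearEquiv.uniqueProd (R := Aᵐᵒᵖ) (M := P.carrier) (M₂ := PUnit.{u + 1}),
      fun _ _ => ⟨fun h => ⟨trivial, h⟩, fun h => h.2⟩⟩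
  add_zero := by
    rintro ⟨P⟩
    exact Quotient.sound ⟨LinearEquiv.prodUnique (R := Aᵐᵒᵖ) (M := P.carrier) (M₂ := PUnit.{u + 1}),
      fun _ _ => ⟨fun h => ⟨h, trivial⟩, fun h => h.1⟩⟩
  add_comm := by
    rintro ⟨P⟩ ⟨Q⟩
    exact Quotient.sound ⟨LinearEquiv.prodComm Aᵐᵒᵖ P.carrier Q.carrier, fun _ _ => and_comm⟩

/-- The shift `[P] ↦ [P(k)]`. -/
def shift (k : ℤ) : Vgr 𝒜 →+ Vgr 𝒜 where
  toFun := Quotient.map (GrProjModule.shift k) fun _ _ ⟨f, hf⟩ => ⟨f, fun i => hf (k + i)⟩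
  map_zero' := rfl
  map_add' := by
    rintro ⟨P⟩ ⟨Q⟩
    rfl

theorem shift_zero : shift 0 = AddMonoidHom.id (Vgr 𝒜) := by
  ext x
  obtain ⟨P⟩ := x
  refine Quotient.sound ⟨LinearEquiv.refl _ _, fun i x => ?_⟩
  change x ∈ P.component i ↔ x ∈ P.component (0 + i)
  rw [zero_add]

theorem shift_add (k l : ℤ) : shift (k + l) = (shift k).comp (shift (𝒜 := 𝒜) l) := by
  ext x
  obtain ⟨P⟩ := x
  refine Quotient.sound ⟨LinearEquiv.refl _ _, fun i x => ?_⟩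
  change x ∈ P.component (l + (k + i)) ↔ x ∈ P.component (k + l + i)
  rw [show l + (k + i) = k + l + i by ring]

end Vgr

/-- The graded Grothendieck group `K₀^gr(A)`: the group completion of `V^gr(A)`. -/
def K0gr : Type (u + 1) := Algebra.GrothendieckAddGroup (Vgr 𝒜)

namespace K0gr

instance : AddCommGroup (K0gr 𝒜) :=
  inferInstanceAs (AddCommGroup (Algebra.GrothendieckAddGroup (Vgr 𝒜)))

/-- The natural homomorphism `V^gr(A) → K₀^gr(A)`. -/
def of : Vgr 𝒜 →+ K0gr 𝒜 := Algebra.GrothendieckAddGroup.of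

variable {𝒜} in
theorem hom_ext {f g : K0gr 𝒜 →+ K0gr 𝒜} (h : f.comp (of 𝒜) = g.comp (of 𝒜)) : f = g :=
  Algebra.GrothendieckAddGroup.lift.symm.injective h

/-- The map `[P] ↦ [P(k)]` on `K₀^gr(A)`. -/
noncomputable def shift (k : ℤ) : K0gr 𝒜 →+ K0gr 𝒜 :=
  Algebra.GrothendieckAddGroup.lift (G := K0gr 𝒜) ((of 𝒜).comp (Vgr.shift k))

theorem shift_comp_of (k : ℤ) : (shift 𝒜 k).comp (of 𝒜) = (of 𝒜).comp (Vgr.shift k) :=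
  (Algebra.GrothendieckAddGroup.lift (G := K0gr 𝒜)).symm_apply_apply ((of 𝒜).comp (Vgr.shift k))

theorem shift_of (k : ℤ) (x : Vgr 𝒜) : shift 𝒜 k (of 𝒜 x) = of 𝒜 (Vgr.shift k x) :=
  DFunLike.congr_fun (shift_comp_of 𝒜 k) x

/-- The action of the group `ℤ` on `K₀^gr(A)` by shifts. -/
noncomputable def shiftHom : Multiplicative ℤ →* AddMonoid.End (K0gr 𝒜) where
  toFun k := shift 𝒜 k.toAdd
  map_one' := hom_ext <| AddMonoidHom.ext fun x => by
    change shift 𝒜 0 (of 𝒜 x) = of 𝒜 x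
    rw [shift_of, Vgr.shift_zero, AddMonoidHom.id_apply]
  map_mul' k l := hom_ext <| AddMonoidHom.ext fun x => by
    change shift 𝒜 (k.toAdd + l.toAdd) (of 𝒜 x) = shift 𝒜 k.toAdd (shift 𝒜 l.toAdd (of 𝒜 x))
    rw [shift_of, shift_of, shift_of, Vgr.shift_add, AddMonoidHom.comp_apply]

/-- The `ℤ[x, x⁻¹]`-module structure on `K₀^gr(A)`, with `x ^ k [P] = [P(k)]`. -/
noncomputable instance : Module ℤ[T;T⁻¹] (K0gr 𝒜) :=
  Module.compHom (K0gr 𝒜)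
    (AddMonoidAlgebra.lift ℤ (AddMonoid.End (K0gr 𝒜)) ℤ (shiftHom 𝒜)).toRingHom

theorem T_smul_of_mk (k : ℤ) (P : GrProjModule 𝒜) :
    (LaurentPolynomial.T k : ℤ[T;T⁻¹]) • of 𝒜 (Vgr.mk P) = of 𝒜 (Vgr.mk (P.shift k)) := by
  have h : AddMonoidAlgebra.lift ℤ (AddMonoid.End (K0gr 𝒜)) ℤ (shiftHom 𝒜)
      (LaurentPolynomial.T k) = shift 𝒜 k :=
    (AddMonoidAlgebra.lift_single _ _ _).trans (one_smul _ _)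
  exact (DFunLike.congr_fun h _).trans (shift_of 𝒜 k _)

/-- The pre-order on `K₀^gr(A)` whose positive cone is the image of `V^gr(A)`. -/
instance : Preorder (K0gr 𝒜) where
  le x y := y - x ∈ AddMonoidHom.mrange (of 𝒜)
  le_refl x := by simp
  le_trans x y z h₁ h₂ := by simpa using add_mem h₂ h₁

end K0gr

end GradedK

/-! ### Directed graphs and Leavitt path algebras -/

/-- A directed graph with vertex set `V`, edge set `E`, source map `s` and range map `r`. -/
structure DirectedGraph (V : Type u) (E : Type v) where
  s : E → V
  r : E → V

namespace DirectedGraph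

variable {V : Type u} {E : Type v} (G : DirectedGraph V E)

/-- No vertex is a sink: every vertex emits at least one edge. -/
def NoSinks : Prop := ∀ v : V, ∃ e : E, G.s e = v

/-- The adjacency matrix: its `(v, w)` entry is the number of edges from `v` to `w`. -/
def adjMatrix [Fintype E] [DecidableEq V] : Matrix V V ℕ :=
  fun v w => (Finset.univ.filter fun e => G.s e = v ∧ G.r e = w).card

/-- The generators of the Leavitt path algebra: vertices, edges and ghost edges. -/
inductive Gen (V : Type u) (E : Type v) : Type (max u v)
  | vertex (v : V)
  | edge (e : E)
  | ghost (e : E)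

/-- Vertices have degree `0`, edges have degree `1`, ghost edges have degree `-1`. -/
def Gen.deg : Gen V E → ℤ
  | .vertex _ => 0
  | .edge _ => 1
  | .ghost _ => -1

variable (K : Type w) [Field K]

section Rel

open FreeAlgebra (ι)
open Gen

/-- The defining relations of the Leavitt path algebra of a finite graph. The free algebra on the
generators is unital here, so the relation `one` is needed to make its identity agree with the
identity `∑ v` of the algebra generated by vertices, edges and ghost edges. -/
inductive LeavittRel [Fintype V] [Fintype E] [DecidableEq V] :
    FreeAlgebra K (Gen V E) → FreeAlgebra K (Gen V E) → Prop
  | one : LeavittRel (∑ v : V, ι K (vertex v)) 1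
  | vertex_idem (v : V) : LeavittRel (ι K (vertex v) * ι K (vertex v)) (ι K (vertex v))
  | vertex_orthogonal (v w : V) (h : v ≠ w) : LeavittRel (ι K (vertex v) * ι K (vertex w)) 0
  | s_edge (e : E) : LeavittRel (ι K (vertex (G.s e)) * ι K (edge e)) (ι K (edge e))
  | edge_r (e : E) : LeavittRel (ι K (edge e) * ι K (vertex (G.r e))) (ι K (edge e))
  | r_ghost (e : E) : LeavittRel (ι K (vertex (G.r e)) * ι K (ghost e)) (ι K (ghost e))
  | ghost_s (e : E) : LeavittRel (ι K (ghost e) * ι K (vertex (G.s e))) (ι K (ghost e))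
  | ghost_edge (e : E) : LeavittRel (ι K (ghost e) * ι K (edge e)) (ι K (vertex (G.r e)))
  | ghost_edge_ne (e f : E) (h : e ≠ f) : LeavittRel (ι K (ghost e) * ι K (edge f)) 0
  | sum_edge_ghost (v : V) (h : ∃ e, G.s e = v) :
      LeavittRel (∑ e : E with G.s e = v, ι K (edge e) * ι K (ghost e)) (ι K (vertex v))

end Rel

variable [Fintype V] [Fintype E] [DecidableEq V]

/-- The Leavitt path algebra `L_K(G)` of a finite graph. -/
abbrev LeavittPathAlgebra : Type (max u v w) := RingQuot (G.LeavittRel K)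

/-- The image of a generator in the Leavitt path algebra. -/
noncomputable def gen (x : Gen V E) : G.LeavittPathAlgebra K :=
  RingQuot.mkAlgHom K (G.LeavittRel K) (FreeAlgebra.ι K x)

/-- The homogeneous elements of degree `k`: linear combinations of words in the generators whose
degrees add up to `k`. -/
def leavittGrading (k : ℤ) : Submodule K (G.LeavittPathAlgebra K) :=
  Submodule.span K {a | ∃ l : List (Gen V E), (l.map Gen.deg).sum = k ∧ (l.map (G.gen K)).prod = a}

theorem gen_mem (x : Gen V E) : G.gen K x ∈ G.leavittGrading K x.deg :=
  Submodule.subset_span ⟨[x], by simp, by simp⟩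

instance : SetLike.GradedMonoid (G.leavittGrading K) where
  one_mem := Submodule.subset_span ⟨[], by simp, by simp⟩
  mul_mem i j a b ha hb := by
    have h : a * b ∈ G.leavittGrading K i * G.leavittGrading K j := Submodule.mul_mem_mul ha hb
    rw [leavittGrading, leavittGrading, Submodule.span_mul_span] at h
    refine Submodule.span_mono ?_ h
    rintro _ ⟨_, ⟨l, hl, rfl⟩, _, ⟨l', hl', rfl⟩, rfl⟩
    exact ⟨l ++ l', by simp [hl, hl'], by simp⟩

/-- A generator as an element of its graded component. -/
noncomputable def genGraded (x : Gen V E) : ⨁ i, G.leavittGrading K i :=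
  DirectSum.of (fun i => G.leavittGrading K i) x.deg ⟨G.gen K x, G.gen_mem K x⟩

theorem gen_rel {a b : FreeAlgebra K (Gen V E)} (h : G.LeavittRel K a b) :
    RingQuot.mkAlgHom K (G.LeavittRel K) a = RingQuot.mkAlgHom K (G.LeavittRel K) b :=
  RingQuot.mkAlgHom_rel K h

theorem directSum_of_eq {i j : ℤ} (h : i = j) {a : G.leavittGrading K i}
    {b : G.leavittGrading K j} (hab : (a : G.LeavittPathAlgebra K) = b) :
    DirectSum.of (fun i => G.leavittGrading K i) i a = DirectSum.of _ j b := by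
  subst h
  exact congrArg _ (Subtype.ext hab)

/-- The splitting of elements of the Leavitt path algebra into homogeneous components. -/
noncomputable def decomposeHom : G.LeavittPathAlgebra K →ₐ[K] ⨁ i, G.leavittGrading K i :=
  RingQuot.liftAlgHom K ⟨FreeAlgebra.lift K (G.genGraded K), by
    intro a b h
    have h' := G.gen_rel K h
    cases h
    case one =>
      simp only [map_sum, map_one, FreeAlgebra.lift_ι_apply, genGraded] at h' ⊢
      refine (map_sum (DirectSum.of (fun i => G.leavittGrading K i) 0)
        (fun v => ⟨G.gen K (.vertex v), G.gen_mem K (.vertex v)⟩) _).symm.trans ?_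
      refine G.directSum_of_eq K rfl ?_
      rw [AddSubmonoidClass.coe_finsetSum]
      exact h'
    case vertex_orthogonal | ghost_edge_ne =>
      simp only [map_mul, map_zero, FreeAlgebra.lift_ι_apply, genGraded, DirectSum.of_mul_of]
        at h' ⊢
      exact (congrArg _ (Subtype.ext h')).trans (map_zero _)
    case sum_edge_ghost =>
      simp only [map_sum, map_mul, FreeAlgebra.lift_ι_apply, genGraded, DirectSum.of_mul_of]
        at h' ⊢
      refine (map_sum (DirectSum.of (fun i => G.leavittGrading K i) (1 + -1))
        (fun e => ⟨G.gen K (.edge e) * G.gen K (.ghost e),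
          SetLike.mul_mem_graded (G.gen_mem K (.edge e)) (G.gen_mem K (.ghost e))⟩) _).symm.trans ?_
      refine G.directSum_of_eq K (add_neg_cancel 1) ?_
      rw [AddSubmonoidClass.coe_finsetSum]
      exact h'
    all_goals
      simp only [map_mul, FreeAlgebra.lift_ι_apply, genGraded, DirectSum.of_mul_of] at h' ⊢
      exact G.directSum_of_eq K rfl h'⟩

theorem decomposeHom_gen (x : Gen V E) : G.decomposeHom K (G.gen K x) = G.genGraded K x := by
  rw [decomposeHom, gen, RingQuot.liftAlgHom_mkAlgHom_apply, FreeAlgebra.lift_ι_apply]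

/-- The Leavitt path algebra is a `ℤ`-graded algebra. -/
noncomputable instance : GradedAlgebra (G.leavittGrading K) := by
  refine GradedAlgebra.ofAlgHom _ (G.decomposeHom K) ?_ ?_
  · refine RingQuot.ringQuot_ext' K _ _ (FreeAlgebra.hom_ext (funext fun x => ?_))
    change DirectSum.coeAlgHom _ (G.decomposeHom K (G.gen K x)) = G.gen K x
    rw [decomposeHom_gen, genGraded, DirectSum.coeAlgHom_of]
  · have hl : ∀ l : List (Gen V E), ∀ i : ℤ, (l.map Gen.deg).sum = i →
        ∀ h : (l.map (G.gen K)).prod ∈ G.leavittGrading K i,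
        G.decomposeHom K (l.map (G.gen K)).prod =
          DirectSum.of (fun i => G.leavittGrading K i) i ⟨_, h⟩ := by
      intro l
      induction l with
      | nil =>
        rintro _ rfl h
        refine (map_one (G.decomposeHom K)).trans ?_
        exact G.directSum_of_eq K rfl rfl
      | cons x l ih =>
        rintro _ rfl h
        have hm : (l.map (G.gen K)).prod ∈ G.leavittGrading K (l.map Gen.deg).sum :=
          Submodule.subset_span ⟨l, rfl, rfl⟩
        simp only [List.map_cons, List.prod_cons, map_mul]
        rw [ih _ rfl hm, decomposeHom_gen, genGraded, DirectSum.of_mul_of]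
        exact G.directSum_of_eq K rfl rfl
    rintro i ⟨x, hx⟩
    change G.decomposeHom K x = _
    induction hx using Submodule.span_induction with
    | mem x h =>
      obtain ⟨l, hd, rfl⟩ := h
      exact hl l i hd _
    | zero => exact (map_zero _).trans (map_zero _).symm
    | add x y hx hy h₁ h₂ => rw [map_add, h₁, h₂, ← map_add]; rfl
    | smul c x hx h =>
      rw [map_smul, h]
      exact (map_smul (DirectSum.lof K ℤ (fun i => G.leavittGrading K i) i) c ⟨x, hx⟩).symm

end DirectedGraph

/-! ### Leavitt families in graded algebras -/

/-! Write `L` for the Leavitt path algebra and `A` for the adjacency matrix. Since every vertex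
satisfies `v = ∑ e e*` over the edges leaving it, `vL` is graded isomorphic to the sum of the
`r(e)L(-1)`, so `x[vL] = ∑ A v w [wL]`.

Every graded finitely generated projective module is a finite sum of modules `vL(-N)` with one
common `N` (`GrFrame.exists_basis`). Indeed any element of degree zero becomes a combination of
vertices when enough ghost edges are multiplied on the left and equally many edges on the right
(`LeavittFamily.exhaust`). Replacing generators by their products with edges therefore makes all
coefficients scalar, and over a field redundant generators can be eliminated.

A module is thus coded by a degree `N` and a vector `a` in `ℕ^V`. The codes `(N, a)` and `(N + 1,
aA)` belong to the same module, and two vectors of one module in the same degree agree after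
multiplication by a power of `A` (`HasDimension.exists_vecMul_pow_eq`), because invertible scalar
matrices are square. Hence `K₀^gr` is Krieger's dimension module: the direct limit of `ℤ^V` under `a
↦ aA`, with `x` acting as `A` and with the images of `ℕ^V` as positive cone. `IsDimensionModule`
records exactly what is needed of this.

The rest is linear algebra. A shift equivalence `(R, S)` of lag `l` gives positive maps whose
composites are the invertible `x^l`. Conversely an ordered isomorphism and its inverse are given, up
to powers of `x`, by nonnegative matrices, which satisfy the equations of a shift equivalence after
multiplication by high powers of the adjacency matrices. -/

/-- A family of vertices, edges and ghost edges in a graded algebra satisfying the relations of the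
Leavitt path algebra of a finite graph without sinks, with nonzero vertices, and such that the
degree zero component is spanned by words of degree zero. -/
structure LeavittFamily {K : Type*} [Field K] {V E : Type*} [Fintype V] [Fintype E] [DecidableEq V]
    [DecidableEq E] (G : DirectedGraph V E) {L : Type u} [Ring L] [Algebra K L]
    (𝒜 : ℤ → Submodule K L) where
  vtx : V → L
  edge : E → L
  ghost : E → L
  sum_vtx : ∑ v, vtx v = 1
  vtx_mul_vtx : ∀ v w, vtx v * vtx w = if v = w then vtx v else 0
  s_edge : ∀ e, vtx (G.s e) * edge e = edge e
  edge_r : ∀ e, edge e * vtx (G.r e) = edge e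
  r_ghost : ∀ e, vtx (G.r e) * ghost e = ghost e
  ghost_s : ∀ e, ghost e * vtx (G.s e) = ghost e
  ghost_edge : ∀ e f, ghost e * edge f = if e = f then vtx (G.r e) else 0
  sum_edge_ghost : ∀ v, ∑ e : {e // G.s e = v}, edge e * ghost e = vtx v
  vtx_mem : ∀ v, vtx v ∈ 𝒜 0
  edge_mem : ∀ e, edge e ∈ 𝒜 1
  ghost_mem : ∀ e, ghost e ∈ 𝒜 (-1)
  vtx_ne_zero : ∀ v, vtx v ≠ 0
  mem_span : ∀ x ∈ 𝒜 0, x ∈ Submodule.span K {a | ∃ l : List (DirectedGraph.Gen V E),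
    (l.map DirectedGraph.Gen.deg).sum = 0 ∧ (l.map fun
      | .vertex v => vtx v
      | .edge e => edge e
      | .ghost e => ghost e).prod = a}

namespace LeavittFamily

variable {K : Type*} [Field K] {V E : Type*} [Fintype V] [Fintype E] [DecidableEq V]
  [DecidableEq E] {G : DirectedGraph V E} {L : Type u} [Ring L] [Algebra K L]
  {𝒜 : ℤ → Submodule K L} (Λ : LeavittFamily G 𝒜)

/-- Multiplication by `m` ghost edges from the left and by `n` edges from the right carries `x` to
scalar combinations of vertices. -/
def Compresses (m n : ℕ) (x : L) : Prop :=
  (Submodule.span K (Set.range Λ.ghost)) ^ m * Submodule.span K {x} *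
    (Submodule.span K (Set.range Λ.edge)) ^ n ≤ Submodule.span K (Set.range Λ.vtx)

/-- The elements compressed into scalar combinations of vertices by paths of length `n`. -/
def level (n : ℕ) : Set L := {x | Λ.Compresses n n x}

theorem mem_level {n : ℕ} {x : L} : x ∈ Λ.level n ↔
    (Submodule.span K (Set.range Λ.ghost)) ^ n * Submodule.span K {x} *
      (Submodule.span K (Set.range Λ.edge)) ^ n ≤ Submodule.span K (Set.range Λ.vtx) :=
  Iff.rfl

theorem ghost_mul_vtx (e : E) (v : V) :
    Λ.ghost e * Λ.vtx v = if v = G.s e then Λ.ghost e else 0 := by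
  rw [← Λ.ghost_s e, mul_assoc, Λ.vtx_mul_vtx]
  split_ifs with h h' h'
  · rfl
  · exact absurd h.symm h'
  · exact absurd h'.symm h
  · simp

theorem edge_mul_ghost_sum (v : V) (x : L) (hx : Λ.vtx v * x = x) :
    ∑ e : {e // G.s e = v}, Λ.edge e * (Λ.ghost e * x) = x := by
  simp only [← mul_assoc]
  rw [← Finset.sum_mul, Λ.sum_edge_ghost, hx]

theorem vtx_mul_self (v : V) : Λ.vtx v * Λ.vtx v = Λ.vtx v := by simp [Λ.vtx_mul_vtx]

theorem ghost_mul_mul_edge_mem_span {x : L} (hx : x ∈ Submodule.span K (Set.range Λ.vtx))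
    (e f : E) : Λ.ghost e * x * Λ.edge f ∈ Submodule.span K (Set.range Λ.vtx) := by
  induction hx using Submodule.span_induction with
  | mem x h =>
    obtain ⟨v, rfl⟩ := h
    rw [Λ.ghost_mul_vtx]
    split_ifs
    · rw [Λ.ghost_edge]
      split_ifs
      · exact Submodule.subset_span ⟨_, rfl⟩
      · exact zero_mem _
    · simp
  | zero => simp
  | add x y _ _ hx hy => rw [mul_add, add_mul]; exact add_mem hx hy
  | smul c x _ h => rw [mul_smul_comm, smul_mul_assoc]; exact Submodule.smul_mem _ _ h

/-- A product `e* v f` is again a vertex or zero, so an extra layer on both sides stays inside the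
span of the vertices. -/
theorem Compresses.succ {Λ : LeavittFamily G 𝒜} {m n : ℕ} {x : L} (hx : Λ.Compresses m n x) :
    Λ.Compresses (m + 1) (n + 1) x := by
  rw [Compresses] at hx ⊢
  rw [pow_succ', pow_succ]
  calc _ = Submodule.span K (Set.range Λ.ghost) * (Submodule.span K (Set.range Λ.ghost) ^ m *
        Submodule.span K {x} * Submodule.span K (Set.range Λ.edge) ^ n) *
        Submodule.span K (Set.range Λ.edge) := by simp only [mul_assoc]
    _ ≤ Submodule.span K (Set.range Λ.ghost) * Submodule.span K (Set.range Λ.vtx) *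
        Submodule.span K (Set.range Λ.edge) := by gcongr
    _ ≤ _ := by
      rw [Submodule.span_mul_span, Submodule.span_mul_span, Submodule.span_le]
      rintro _ ⟨_, ⟨_, ⟨e, rfl⟩, _, ⟨v, rfl⟩, rfl⟩, _, ⟨f, rfl⟩, rfl⟩
      exact Λ.ghost_mul_mul_edge_mem_span (Submodule.subset_span ⟨v, rfl⟩) e f

theorem level_succ (n : ℕ) : Λ.level n ⊆ Λ.level (n + 1) := fun _ hx => Compresses.succ hx

theorem level_mono : Monotone Λ.level := monotone_nat_of_le_succ Λ.level_succ

/-- The outer `e*` and `f` use up one of the `n + 1` layers. This is how refining a frame lowers the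
level of its coefficients. -/
theorem ghost_mul_edge_mem_level {n : ℕ} {x : L} (hx : x ∈ Λ.level (n + 1)) (e f : E) :
    Λ.ghost e * x * Λ.edge f ∈ Λ.level n := by
  rw [mem_level] at hx ⊢
  refine le_trans ?_ hx
  rw [pow_succ, pow_succ']
  calc _ = Submodule.span K (Set.range Λ.ghost) ^ n * (Submodule.span K {Λ.ghost e} *
        Submodule.span K {x} * Submodule.span K {Λ.edge f}) *
        Submodule.span K (Set.range Λ.edge) ^ n := by
        simp only [Submodule.span_mul_span, Set.singleton_mul_singleton]
    _ ≤ Submodule.span K (Set.range Λ.ghost) ^ n * (Submodule.span K (Set.range Λ.ghost) *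
        Submodule.span K {x} * Submodule.span K (Set.range Λ.edge)) *
        Submodule.span K (Set.range Λ.edge) ^ n := by
        gcongr
        · exact Set.singleton_subset_iff.2 ⟨_, rfl⟩
        · exact Set.singleton_subset_iff.2 ⟨_, rfl⟩
    _ = _ := by simp only [mul_assoc]

theorem mem_level_zero {x : L} : x ∈ Λ.level 0 ↔ x ∈ Submodule.span K (Set.range Λ.vtx) := by
  rw [mem_level, pow_zero, pow_zero, one_mul, mul_one,
    Submodule.span_singleton_le_iff_mem]

/-- Vertices are orthogonal idempotents, so cutting a combination of them by `v` and `w` leaves one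
term or none. Coefficients of level zero thereby become a scalar matrix, block diagonal with respect
to the vertices. -/
theorem exists_coeff {x : L} (hx : x ∈ Λ.level 0) {v w : V} (hv : Λ.vtx v * x = x)
    (hw : x * Λ.vtx w = x) : ∃ c : K, x = c • Λ.vtx v ∧ (v ≠ w → c = 0) := by
  obtain ⟨c, rfl⟩ := (Submodule.mem_span_range_iff_exists_fun K).1 (Λ.mem_level_zero.1 hx)
  have h1 : ∑ i, c i • Λ.vtx i = c v • Λ.vtx v := by
    rw [← hv, Finset.mul_sum]
    simp [Λ.vtx_mul_vtx]
  rw [h1] at hw ⊢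
  refine ⟨if v = w then c v else 0, ?_, fun h => if_neg h⟩
  rw [← hw, smul_mul_assoc, Λ.vtx_mul_vtx]
  split_ifs <;> simp

theorem smul_vtx_injective (v : V) : Function.Injective fun c : K => c • Λ.vtx v :=
  smul_left_injective K (Λ.vtx_ne_zero v)

theorem ghost_span_mul_vtx_span_le :
    Submodule.span K (Set.range Λ.ghost) * Submodule.span K (Set.range Λ.vtx) ≤
      Submodule.span K (Set.range Λ.ghost) := by
  rw [Submodule.span_mul_span, Submodule.span_le]
  rintro _ ⟨_, ⟨e, rfl⟩, _, ⟨v, rfl⟩, rfl⟩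
  dsimp only
  rw [Λ.ghost_mul_vtx]
  split_ifs
  · exact Submodule.subset_span ⟨e, rfl⟩
  · exact zero_mem _

theorem ghost_span_mul_edge_le (f : E) :
    Submodule.span K (Set.range Λ.ghost) * Submodule.span K {Λ.edge f} ≤
      Submodule.span K (Set.range Λ.vtx) := by
  rw [Submodule.span_mul_span, Submodule.span_le]
  rintro _ ⟨_, ⟨e, rfl⟩, _, rfl, rfl⟩
  dsimp only
  rw [Λ.ghost_edge]
  split_ifs
  · exact Submodule.subset_span ⟨_, rfl⟩
  · exact zero_mem _

theorem Compresses.mul_left {Λ : LeavittFamily G 𝒜} {m m' n : ℕ} {x g : L}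
    (hx : Λ.Compresses m n x)
    (hg : Submodule.span K (Set.range Λ.ghost) ^ m' * Submodule.span K {g} ≤
      Submodule.span K (Set.range Λ.ghost) ^ m) : Λ.Compresses m' n (g * x) := by
  rw [Compresses] at hx ⊢
  refine le_trans ?_ hx
  rw [← Set.singleton_mul_singleton, ← Submodule.span_mul_span, ← mul_assoc]
  gcongr

/-- Letters are added on the left, where ghost edges meet them: a vertex is absorbed by a ghost
edge, an edge cancels one, and a ghost edge supplies one. In every case `Compresses.succ` first
provides spare ghost edges, and `m - n` records the degree. -/
theorem exists_compresses_word (l : List (DirectedGraph.Gen V E)) : ∃ m n : ℕ,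
    (m : ℤ) - n = (l.map DirectedGraph.Gen.deg).sum ∧ Λ.Compresses m n (l.map fun
      | .vertex v => Λ.vtx v
      | .edge e => Λ.edge e
      | .ghost e => Λ.ghost e).prod := by
  induction l with
  | nil =>
    refine ⟨0, 0, by simp, ?_⟩
    rw [Compresses, pow_zero, pow_zero, one_mul, mul_one, Submodule.span_singleton_le_iff_mem,
      List.map_nil, List.prod_nil, ← Λ.sum_vtx]
    exact sum_mem fun v _ => Submodule.subset_span ⟨v, rfl⟩
  | cons g l ih =>
    obtain ⟨m, n, hd, h⟩ := ih
    rw [List.map_cons, List.map_cons, List.sum_cons, List.prod_cons, ← hd]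
    cases g with
    | vertex v =>
      refine ⟨m + 1, n + 1, by simp [DirectedGraph.Gen.deg], h.succ.mul_left ?_⟩
      rw [pow_succ, mul_assoc]
      gcongr
      refine le_trans ?_ Λ.ghost_span_mul_vtx_span_le
      gcongr
      exact Set.singleton_subset_iff.2 ⟨v, rfl⟩
    | edge e =>
      refine ⟨m + 1 + 1, n + 1, by simp [DirectedGraph.Gen.deg]; ring, h.succ.mul_left ?_⟩
      rw [pow_succ, mul_assoc]
      calc _ ≤ Submodule.span K (Set.range Λ.ghost) ^ (m + 1) *
            Submodule.span K (Set.range Λ.vtx) := by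
            gcongr
            exact Λ.ghost_span_mul_edge_le e
        _ ≤ _ := by
          rw [pow_succ, mul_assoc]
          gcongr
          exact Λ.ghost_span_mul_vtx_span_le
    | ghost e =>
      refine ⟨m, n + 1, by simp [DirectedGraph.Gen.deg]; ring, h.succ.mul_left ?_⟩
      rw [pow_succ]
      gcongr
      exact Set.singleton_subset_iff.2 ⟨e, rfl⟩

/-- Words of degree zero need equally many layers on both sides; a sum lies in the larger of the two
levels. -/
theorem exhaust (x : L) (hx : x ∈ 𝒜 0) : ∃ n, x ∈ Λ.level n := by
  have hx' := Λ.mem_span x hx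
  clear hx
  induction hx' using Submodule.span_induction with
  | mem x h =>
    obtain ⟨l, hl, rfl⟩ := h
    obtain ⟨m, n, hd, h⟩ := Λ.exists_compresses_word l
    obtain rfl : m = n := by omega
    exact ⟨m, h⟩
  | zero => exact ⟨0, Λ.mem_level_zero.2 (zero_mem _)⟩
  | add x y _ _ hx hy =>
    obtain ⟨n, hn⟩ := hx
    obtain ⟨m, hm⟩ := hy
    refine ⟨max n m, ?_⟩
    have hn' := Λ.mem_level.1 (Λ.level_mono (le_max_left n m) hn)
    have hm' := Λ.mem_level.1 (Λ.level_mono (le_max_right n m) hm)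
    rw [mem_level]
    refine le_trans ?_ (sup_le hn' hm')
    rw [← Submodule.add_eq_sup, ← add_mul, ← mul_add]
    gcongr
    rw [Submodule.span_singleton_le_iff_mem, Submodule.add_eq_sup]
    exact Submodule.add_mem_sup (Submodule.mem_span_singleton_self x)
      (Submodule.mem_span_singleton_self y)
  | smul c x _ h =>
    obtain ⟨n, hn⟩ := h
    refine ⟨n, ?_⟩
    rw [mem_level] at hn ⊢
    refine (mul_le_mul' (mul_le_mul' le_rfl ?_) le_rfl).trans hn
    rw [Submodule.span_singleton_le_iff_mem]
    exact Submodule.smul_mem _ _ (Submodule.mem_span_singleton_self x)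

variable [GradedAlgebra 𝒜]

include Λ in
/-- For every `k` the identity is a sum of products of elements of degrees `k` and `-k`. -/
theorem exists_sum_mul_eq_one (k : ℕ) : ∃ (n : ℕ) (a b : Fin n → L), (∀ t, a t ∈ 𝒜 k) ∧
    (∀ t, b t ∈ 𝒜 (-k)) ∧ ∑ t, a t * b t = 1 := by
  have hone : ∑ e, Λ.edge e * Λ.ghost e = 1 := by
    rw [← Λ.sum_vtx, ← Fintype.sum_fiberwise G.s]
    exact Finset.sum_congr rfl fun v _ => Λ.sum_edge_ghost v
  suffices h : ∃ (T : Type) (_ : Fintype T) (a b : T → L), (∀ t, a t ∈ 𝒜 k) ∧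
      (∀ t, b t ∈ 𝒜 (-k)) ∧ ∑ t, a t * b t = 1 by
    obtain ⟨T, _, a, b, ha, hb, h⟩ := h
    let e := (Fintype.equivFin T).symm
    exact ⟨_, a ∘ e, b ∘ e, fun _ => ha _, fun _ => hb _,
      (Equiv.sum_comp e fun t => a t * b t).trans h⟩
  induction k with
  | zero => exact ⟨Unit, inferInstance, 1, 1, fun _ => by simpa using SetLike.one_mem_graded 𝒜,
      fun _ => by simpa using SetLike.one_mem_graded 𝒜, by simp⟩
  | succ k ih =>
    obtain ⟨T, _, a, b, ha, hb, h⟩ := ih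
    -- The identity `∑ e e* = 1` is inserted between `a t` and `b t`. Numbering the edges keeps the
    -- new index set in `Type`.
    let ε := (Fintype.equivFin E).symm
    refine ⟨T × Fin (Fintype.card E), inferInstance, fun t => a t.1 * Λ.edge (ε t.2),
      fun t => Λ.ghost (ε t.2) * b t.1, fun t => ?_, fun t => ?_, ?_⟩
    · exact_mod_cast SetLike.mul_mem_graded (ha t.1) (Λ.edge_mem _)
    · have := SetLike.mul_mem_graded (Λ.ghost_mem (ε t.2)) (hb t.1)
      convert this using 2
      push_cast
      ring
    · rw [Fintype.sum_prod_type, ← h]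
      refine Finset.sum_congr rfl fun t _ => ?_
      calc _ = a t * (∑ j, Λ.edge (ε j) * Λ.ghost (ε j)) * b t := by
            simp only [Finset.mul_sum, Finset.sum_mul, mul_assoc]
        _ = _ := by rw [Equiv.sum_comp ε fun e => Λ.edge e * Λ.ghost e, hone, mul_one]

end LeavittFamily

/-! ### Dual bases of graded projective modules -/

section Frames

variable {K : Type*} [Field K] {V E : Type*} [Fintype V] [Fintype E] [DecidableEq V]
  [DecidableEq E] {G : DirectedGraph V E} {L : Type u} [Ring L] [Algebra K L]
  {𝒜 : ℤ → Submodule K L}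

/-- A homogeneous dual generating system of the graded module `P`: generators `p i` of degree `N`
supported at the vertex `v i`, and homogeneous coordinate functions `f i`. -/
structure GrFrame (Λ : LeavittFamily G 𝒜) (P : GrProjModule 𝒜) (N : ℤ) {I : Type*} [Fintype I]
    (v : I → V) where
  p : I → P.carrier
  f : I → P.carrier →ₗ[Lᵐᵒᵖ] L
  p_mem : ∀ i, p i ∈ P.component N
  f_mem : ∀ i k x, x ∈ P.component k → f i x ∈ 𝒜 (k - N)
  p_vtx : ∀ i, op (Λ.vtx (v i)) • p i = p i
  vtx_f : ∀ i x, Λ.vtx (v i) * f i x = f i x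
  sum_eq : ∀ x, ∑ i, op (f i x) • p i = x

namespace GrFrame

variable {Λ : LeavittFamily G 𝒜} {P Q : GrProjModule 𝒜} {N : ℤ} {I J : Type*} [Fintype I]
  [Fintype J] {v : I → V} {w : J → V}

theorem f_mul (F : GrFrame Λ P N v) (i : I) (x : P.carrier) (a : L) :
    F.f i (op a • x) = F.f i x * a := by
  rw [map_smul]; rfl

theorem f_p_mul_vtx (F : GrFrame Λ P N v) (B : GrFrame Λ P N w) (i : I) (j : J) :
    F.f i (B.p j) * Λ.vtx (w j) = F.f i (B.p j) := by
  rw [← F.f_mul, B.p_vtx]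

theorem f_p_mem (F : GrFrame Λ P N v) (B : GrFrame Λ P N w) (i : I) (j : J) :
    F.f i (B.p j) ∈ 𝒜 0 := by
  simpa using F.f_mem i N _ (B.p_mem j)

theorem sum_f_mul_f (F : GrFrame Λ P N v) (f : P.carrier →ₗ[Lᵐᵒᵖ] L) (x : P.carrier) :
    ∑ i, f (F.p i) * F.f i x = f x := by
  conv_rhs => rw [← F.sum_eq x, map_sum]
  exact Finset.sum_congr rfl fun i _ => (map_smul f _ _).symm

/-- The coordinates and the generators are dual to each other. -/
def IsBasis (F : GrFrame Λ P N v) : Prop :=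
  (∀ i, F.f i (F.p i) = Λ.vtx (v i)) ∧ ∀ i j, i ≠ j → F.f i (F.p j) = 0

/-- Transport along a bijection of index sets. -/
def reindex (F : GrFrame Λ P N v) (e : J ≃ I) (h : ∀ j, v (e j) = w j) : GrFrame Λ P N w where
  p j := F.p (e j)
  f j := F.f (e j)
  p_mem _ := F.p_mem _
  f_mem _ := F.f_mem _
  p_vtx j := by rw [← h, F.p_vtx]
  vtx_f j x := by rw [← h, F.vtx_f]
  sum_eq x := (Equiv.sum_comp e fun i => op (F.f i x) • F.p i).trans (F.sum_eq x)

theorem IsBasis.reindex {F : GrFrame Λ P N v} (hF : F.IsBasis) (e : J ≃ I)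
    (h : ∀ j, v (e j) = w j) : (F.reindex e h).IsBasis :=
  ⟨fun j => (hF.1 (e j)).trans (by rw [h]), fun _ _ hij => hF.2 _ _ (e.injective.ne hij)⟩

/-- Multiplying the generators by the edges starting at their vertices. -/
def refine [SetLike.GradedMonoid 𝒜] (F : GrFrame Λ P N v) :
    GrFrame Λ P (N + 1) (fun i : (Σ i, {e // G.s e = v i}) => G.r i.2) where
  p i := op (Λ.edge i.2) • F.p i.1
  f i := LinearMap.mulLeft Lᵐᵒᵖ (Λ.ghost i.2) ∘ₗ F.f i.1
  p_mem i := P.smul_mem (F.p_mem _) (Λ.edge_mem _)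
  f_mem i k x hx := by
    have := SetLike.mul_mem_graded (Λ.ghost_mem i.2) (F.f_mem i.1 k x hx)
    rwa [show -1 + (k - N) = k - (N + 1) by ring] at this
  p_vtx i := by rw [smul_smul, ← MulOpposite.op_mul, Λ.edge_r]
  vtx_f i x := by
    change _ * (Λ.ghost _ * _) = Λ.ghost _ * _
    rw [← mul_assoc, Λ.r_ghost]
  sum_eq x := by
    conv_rhs => rw [← F.sum_eq x]
    rw [Fintype.sum_sigma]
    refine Finset.sum_congr rfl fun i _ => ?_
    conv_rhs => rw [← Λ.edge_mul_ghost_sum (v i) (F.f i x) (F.vtx_f i x), Finset.op_sum,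
      Finset.sum_smul]
    refine Finset.sum_congr rfl fun e _ => ?_
    rw [smul_smul, ← MulOpposite.op_mul]
    rfl

theorem refine_f [SetLike.GradedMonoid 𝒜] (F : GrFrame Λ P N v)
    (i : Σ i, {e // G.s e = v i}) (x : P.carrier) :
    F.refine.f i x = Λ.ghost i.2 * F.f i.1 x := rfl

theorem refine_p [SetLike.GradedMonoid 𝒜] (F : GrFrame Λ P N v) (i : Σ i, {e // G.s e = v i}) :
    F.refine.p i = op (Λ.edge i.2.1) • F.p i.1 := rfl

theorem refine_f_refine_p [SetLike.GradedMonoid 𝒜] (F : GrFrame Λ P N v) (B : GrFrame Λ P N w)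
    (i : Σ i, {e // G.s e = v i}) (j : Σ j, {e // G.s e = w j}) :
    F.refine.f i (B.refine.p j) = Λ.ghost i.2 * F.f i.1 (B.p j.1) * Λ.edge j.2 := by
  rw [refine_f, refine_p, f_mul, mul_assoc]

/-- Duality is preserved because distinct edges at one vertex satisfy `e* f = 0`, while `e* e =
r(e)`. -/
theorem IsBasis.refine [SetLike.GradedMonoid 𝒜] {F : GrFrame Λ P N v} (hF : F.IsBasis) :
    F.refine.IsBasis := by
  constructor
  · rintro ⟨i, e, he⟩
    rw [refine_f_refine_p]
    dsimp only
    rw [hF.1, ← he, Λ.ghost_s, Λ.ghost_edge, if_pos rfl]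
  · rintro ⟨i, e, he⟩ ⟨j, f, hf⟩ h
    rw [refine_f_refine_p]
    dsimp only
    by_cases hij : i = j
    · subst hij
      rw [hF.1, ← he, Λ.ghost_s, Λ.ghost_edge, if_neg]
      rintro rfl
      exact h rfl
    · rw [hF.2 i j hij, mul_zero, zero_mul]

/-- Frames of a graded module are frames of its shifts. -/
def shift (F : GrFrame Λ P N v) (k : ℤ) : GrFrame Λ (P.shift k) (N - k) v where
  p := F.p
  f := F.f
  p_mem i := by
    change F.p i ∈ P.component (k + (N - k))
    rw [add_sub_cancel]
    exact F.p_mem i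
  f_mem i l x hx := by
    rw [show l - (N - k) = k + l - N by ring]
    exact F.f_mem i (k + l) x hx
  p_vtx := F.p_vtx
  vtx_f := F.vtx_f
  sum_eq := F.sum_eq

/-- The direct sum of frames. -/
def prod (F : GrFrame Λ P N v) (B : GrFrame Λ Q N w) :
    GrFrame Λ (P.prod Q) N (Sum.elim v w) where
  p := Sum.elim (fun i => ((F.p i, 0) : P.carrier × Q.carrier))
    fun j => ((0, B.p j) : P.carrier × Q.carrier)
  f := Sum.elim (fun i => (F.f i).comp (LinearMap.fst Lᵐᵒᵖ P.carrier Q.carrier))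
    fun j => (B.f j).comp (LinearMap.snd Lᵐᵒᵖ P.carrier Q.carrier)
  p_mem := by
    rintro (i | i)
    · exact ⟨F.p_mem i, zero_mem _⟩
    · exact ⟨zero_mem _, B.p_mem i⟩
  f_mem := by
    rintro (i | i) k x hx
    · exact F.f_mem i k _ hx.1
    · exact B.f_mem i k _ hx.2
  p_vtx := by
    rintro (i | i)
    · exact Prod.ext (F.p_vtx i) (smul_zero _)
    · exact Prod.ext (smul_zero _) (B.p_vtx i)
  vtx_f := by
    rintro (i | i) x
    · exact F.vtx_f i x.1
    · exact B.vtx_f i x.2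
  sum_eq := by
    rintro ⟨x, y⟩
    rw [Fintype.sum_sum_type]
    have h1 : ∑ i, op (F.f i x) • ((F.p i, 0) : P.carrier × Q.carrier) = (x, 0) := by
      simp only [Prod.smul_mk, smul_zero]
      ext
      · simp only [Prod.fst_sum]
        exact F.sum_eq x
      · simp [Prod.snd_sum]
    have h2 : ∑ i, op (B.f i y) • ((0, B.p i) : P.carrier × Q.carrier) = (0, y) := by
      simp only [Prod.smul_mk, smul_zero]
      ext
      · simp [Prod.fst_sum]
      · simp only [Prod.snd_sum]
        exact B.sum_eq y
    refine (congrArg₂ (· + ·) h1 h2).trans ?_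
    exact Prod.ext (add_zero _) (zero_add _)

theorem IsBasis.prod {F : GrFrame Λ P N v} {B : GrFrame Λ Q N w} (hF : F.IsBasis)
    (hB : B.IsBasis) : (F.prod B).IsBasis := by
  constructor
  · rintro (i | i)
    · exact hF.1 i
    · exact hB.1 i
  · rintro (i | i) (j | j) h
    · exact hF.2 i j fun h' => h (congrArg _ h')
    · exact map_zero (F.f i)
    · exact map_zero (B.f i)
    · exact hB.2 i j fun h' => h (congrArg _ h')

/-- Graded isomorphisms transport frames. -/
theorem exists_of_grIso (F : GrFrame Λ P N v) (hF : F.IsBasis) (h : GrProjModule.GrIso P Q) :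
    ∃ B : GrFrame Λ Q N v, B.IsBasis := by
  obtain ⟨φ, hφ⟩ := h
  refine ⟨⟨fun i => φ (F.p i), fun i => (F.f i).comp φ.symm.toLinearMap, fun i => ?_,
    fun i k x hx => ?_, fun i => ?_, fun i x => F.vtx_f _ _, fun x => ?_⟩, fun i => ?_,
    fun i j hij => ?_⟩
  · exact (hφ _ _).2 (F.p_mem i)
  · exact F.f_mem i k _ ((hφ _ _).1 (by simpa using hx))
  · rw [← map_smul, F.p_vtx]
  · have := congrArg φ (F.sum_eq (φ.symm x))
    simpa using this
  · simpa using hF.1 i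
  · simpa using hF.2 i j hij

variable (F : GrFrame Λ P N v) (B : GrFrame Λ Q N v)

/-- The homomorphism matching the generators of two frames. -/
noncomputable def hom : P.carrier →ₗ[Lᵐᵒᵖ] Q.carrier where
  toFun x := ∑ i, op (F.f i x) • B.p i
  map_add' x y := by
    simp only [map_add, MulOpposite.op_add, add_smul, Finset.sum_add_distrib]
  map_smul' a x := by
    induction a using MulOpposite.rec' with | _ a =>
    simp only [F.f_mul, RingHom.id_apply, Finset.smul_sum, smul_smul, MulOpposite.op_mul]

theorem hom_apply (x : P.carrier) : F.hom B x = ∑ i, op (F.f i x) • B.p i := rfl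

theorem hom_mem {k : ℤ} {x : P.carrier} (hx : x ∈ P.component k) :
    F.hom B x ∈ Q.component k := by
  rw [hom_apply]
  refine sum_mem fun i _ => ?_
  have := Q.smul_mem (B.p_mem i) (F.f_mem i k x hx)
  rwa [add_sub_cancel] at this

theorem hom_hom (hB : B.IsBasis) (x : P.carrier) : B.hom F (F.hom B x) = x := by
  -- As `B` is dual, the image of `x` has in `B` the coordinates that `x` has in `F`.
  have h (i : I) : B.f i (F.hom B x) = F.f i x := by
    rw [hom_apply, map_sum, Finset.sum_eq_single i]
    · rw [B.f_mul, hB.1, F.vtx_f]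
    · intro j _ hj
      rw [B.f_mul, hB.2 i j hj.symm, zero_mul]
    · simp
  rw [hom_apply]
  simp only [h, F.sum_eq]

/-- Modules with bases at the same vertices are graded isomorphic. -/
theorem grIso (hF : F.IsBasis) (hB : B.IsBasis) : GrProjModule.GrIso P Q :=
  ⟨LinearEquiv.ofLinearMap (F.hom B) (B.hom F) (LinearMap.ext fun x => B.hom_hom F hF x)
    (LinearMap.ext fun x => F.hom_hom B hB x), fun _ x =>
    ⟨fun h => by simpa [F.hom_hom B hB] using B.hom_mem F h, fun h => F.hom_mem B h⟩⟩

end GrFrame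

end Frames

/-! ### Homogeneous components and homogeneous dual generating systems -/

section Homogeneous

variable {K : Type*} [Field K] {L : Type u} [Ring L] [Algebra K L] {𝒜 : ℤ → Submodule K L}

namespace GrProjModule

noncomputable instance (P : GrProjModule 𝒜) : DirectSum.Decomposition P.component :=
  P.isInternal.chooseDecomposition

/-- The projection onto a homogeneous component. -/
noncomputable def proj (P : GrProjModule 𝒜) (k : ℤ) : P.carrier →+ P.carrier :=
  (P.component k).subtype.comp <|
    (DFinsupp.evalAddMonoidHom k).comp (DirectSum.decomposeAddEquiv P.component).toAddMonoidHom

theorem proj_mem (P : GrProjModule 𝒜) (k : ℤ) (x : P.carrier) : P.proj k x ∈ P.component k :=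
  (DirectSum.decompose P.component x k).2

theorem proj_same (P : GrProjModule 𝒜) {k : ℤ} {x : P.carrier} (hx : x ∈ P.component k) :
    P.proj k x = x :=
  DirectSum.decompose_of_mem_same P.component hx

theorem proj_of_ne (P : GrProjModule 𝒜) {k l : ℤ} {x : P.carrier} (hx : x ∈ P.component k)
    (h : k ≠ l) : P.proj l x = 0 :=
  DirectSum.decompose_of_mem_ne P.component hx h

/-- Allowing every larger `T` lets one finite set of degrees serve all generators at once. -/
theorem exists_sum_proj (P : GrProjModule 𝒜) (x : P.carrier) :
    ∃ S : Finset ℤ, ∀ T, S ⊆ T → ∑ k ∈ T, P.proj k x = x := by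
  classical
  refine ⟨(DirectSum.decompose P.component x).support, fun T hT => ?_⟩
  conv_rhs => rw [← DirectSum.sum_support_decompose P.component x]
  refine (Finset.sum_subset hT fun k _ hk => ?_).symm
  change ((DirectSum.decompose P.component x k : P.component k) : P.carrier) = 0
  rw [DFinsupp.notMem_support_iff.1 hk, ZeroMemClass.coe_zero]

variable [GradedAlgebra 𝒜]

theorem proj_smul (P : GrProjModule 𝒜) {d : ℤ} {x : P.carrier} (hx : x ∈ P.component d) (a : L)
    (k : ℤ) : P.proj k (op a • x) = op (GradedRing.proj 𝒜 (k - d) a) • x := by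
  induction a using DirectSum.Decomposition.inductionOn 𝒜 with
  | zero => simp
  | @homogeneous j a =>
    have h := P.smul_mem hx a.2
    by_cases hk : d + j = k
    · subst hk
      rw [P.proj_same h, GradedRing.proj_apply, DirectSum.decompose_of_mem_same]
      simp
    · rw [P.proj_of_ne h hk, GradedRing.proj_apply, DirectSum.decompose_of_mem_ne 𝒜 a.2,
        MulOpposite.op_zero, zero_smul]
      omega
  | add a b ha hb => 
    rw [MulOpposite.op_add, add_smul, map_add, ha, hb, map_add, MulOpposite.op_add, add_smul]

/-- Homogeneous parts of a linear form. -/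
theorem exists_homogeneous_part (P : GrProjModule 𝒜) (f : P.carrier →ₗ[Lᵐᵒᵖ] L) (N : ℤ) :
    ∃ g : P.carrier →ₗ[Lᵐᵒᵖ] L, ∀ k, ∀ x ∈ P.component k,
      g x = GradedRing.proj 𝒜 (k - N) (f x) := by
  let g : P.carrier →+ L := (DirectSum.toAddMonoid fun k => (GradedRing.proj 𝒜 (k - N)).comp
    (f.toAddMonoidHom.comp (P.component k).subtype)).comp
    (DirectSum.decomposeAddEquiv P.component).toAddMonoidHom
  have hg : ∀ k, ∀ x ∈ P.component k, g x = GradedRing.proj 𝒜 (k - N) (f x) := by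
    intro k x hx
    have : DirectSum.decomposeAddEquiv P.component x = DirectSum.of _ k ⟨x, hx⟩ :=
      DirectSum.decompose_of_mem P.component hx
    change DirectSum.toAddMonoid _ (DirectSum.decomposeAddEquiv P.component x) = _
    rw [this, DirectSum.toAddMonoid_of]
    rfl
  refine ⟨⟨⟨g, map_add g⟩, fun a x => ?_⟩, hg⟩
  induction a using MulOpposite.rec' with | _ a =>
  change g (op a • x) = g x * a
  induction x using DirectSum.Decomposition.inductionOn P.component with
  | zero => simp
  | @homogeneous k x =>
    induction a using DirectSum.Decomposition.inductionOn 𝒜 with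
    | zero => simp
    | @homogeneous j a =>
      rw [hg _ _ (P.smul_mem x.2 a.2), hg _ _ x.2, map_smul]
      change GradedRing.proj 𝒜 _ (f x * a) = _
      rw [GradedRing.proj_apply, GradedRing.proj_apply, add_sub_right_comm,
        ← DirectSum.coe_decompose_mul_add_of_right_mem 𝒜 a.2]
    | add a b ha hb => rw [MulOpposite.op_add, add_smul, map_add, ha, hb, mul_add]
  | add x y hx hy => rw [smul_add, map_add, hx, hy, map_add, add_mul]

/-- A graded finitely generated projective module has a homogeneous dual generating system. -/
theorem exists_homogeneous_dual (P : GrProjModule 𝒜) :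
    ∃ (n : ℕ) (D : Finset ℤ) (p : Fin n → ℤ → P.carrier) (f : Fin n → ℤ → P.carrier →ₗ[Lᵐᵒᵖ] L),
      (∀ i d, p i d ∈ P.component d) ∧
      (∀ i d k x, x ∈ P.component k → f i d x ∈ 𝒜 (k - d)) ∧
      ∀ x, ∑ i, ∑ d ∈ D, op (f i d x) • p i d = x := by
  obtain ⟨n, π, hπ⟩ := Module.Finite.exists_fin' Lᵐᵒᵖ P.carrier
  obtain ⟨σ, hσ⟩ := Module.projective_lifting_property π LinearMap.id hπ
  let u : Lᵐᵒᵖ →ₗ[Lᵐᵒᵖ] L := ⟨⟨MulOpposite.unop, fun _ _ => rfl⟩, fun _ _ => rfl⟩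
  let p : Fin n → P.carrier := fun i => π fun j => if i = j then 1 else 0
  let f : Fin n → P.carrier →ₗ[Lᵐᵒᵖ] L := fun i => u ∘ₗ LinearMap.proj i ∘ₗ σ
  -- An ungraded dual basis from a splitting of a free cover; it is made homogeneous afterwards.
  have hpf : ∀ x, ∑ i, op (f i x) • p i = x := fun x =>
    (LinearMap.pi_apply_eq_sum_univ π (σ x)).symm.trans (DFunLike.congr_fun hσ x)
  choose S hS using fun i => P.exists_sum_proj (p i)
  choose g hg using fun i d => P.exists_homogeneous_part (f i) d
  have hD : ∀ i, S i ⊆ Finset.univ.biUnion S := fun i =>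
    Finset.subset_biUnion_of_mem S (Finset.mem_univ i)
  refine ⟨n, Finset.univ.biUnion S, fun i d => P.proj d (p i), g, fun i d => P.proj_mem _ _,
    fun i d k x hx => ?_, fun x => ?_⟩
  · rw [hg i d k x hx]
    exact SetLike.coe_mem _
  · induction x using DirectSum.Decomposition.inductionOn P.component with
    | zero => simp
    | @homogeneous k x =>
      -- In the degree `k` part of `∑ p i * f i x`, the component of `p i` of degree `d` meets only
      -- the component of `f i x` of degree `k - d`.
      conv_rhs => rw [← P.proj_same x.2, ← hpf x, map_sum]
      refine Finset.sum_congr rfl fun i _ => ?_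
      conv_rhs => rw [← hS i _ (hD i), Finset.smul_sum, map_sum]
      refine Finset.sum_congr rfl fun d _ => ?_
      rw [P.proj_smul (P.proj_mem _ _), hg i d k x x.2]
    | add x y hx hy =>
      conv_rhs => rw [← hx, ← hy]
      simp only [map_add, MulOpposite.op_add, add_smul, Finset.sum_add_distrib]

end GrProjModule

end Homogeneous

/-! ### Existence of bases -/

section Bases

variable {K : Type*} [Field K] {V E : Type*} [Fintype V] [Fintype E] [DecidableEq V]
  [DecidableEq E] {G : DirectedGraph V E} {L : Type u} [Ring L] [Algebra K L]
  {𝒜 : ℤ → Submodule K L} [GradedAlgebra 𝒜]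

namespace GrFrame

/-- Every graded finitely generated projective module has a frame. -/
theorem exists_frame (Λ : LeavittFamily G 𝒜) (P : GrProjModule 𝒜) :
    ∃ (N : ℤ) (m : ℕ) (v : Fin m → V), Nonempty (GrFrame Λ P N v) := by
  obtain ⟨n, D, p, f, hp, hf, hs⟩ := P.exists_homogeneous_dual
  -- All generators are pushed up to a common degree. An upper bound is taken because
  -- `exists_sum_mul_eq_one` treats natural degrees, here `N - d`.
  obtain ⟨N, hN⟩ : ∃ N : ℤ, ∀ d ∈ D, d ≤ N := D.bddAbove
  have key : ∀ d : D, ∃ (n : ℕ) (a b : Fin n → L), (∀ t, a t ∈ 𝒜 (N - d)) ∧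
      (∀ t, b t ∈ 𝒜 (d - N)) ∧ ∑ t, a t * b t = 1 := fun d => by
    obtain ⟨n, a, b, ha, hb, h⟩ := Λ.exists_sum_mul_eq_one (N - d).toNat
    have hd : ((N - d).toNat : ℤ) = N - d := Int.toNat_of_nonneg (sub_nonneg.2 (hN d d.2))
    rw [hd] at ha hb
    rw [neg_sub] at hb
    exact ⟨n, a, b, ha, hb, h⟩
  choose n' a b ha hb hab using key
  -- Between `p i d` and `f i d x` are inserted `1 = ∑ a t * b t` and `1 = ∑ v = ∑ v * v`; the left
  -- halves go to the generators and the right halves to the coordinates.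
  let F : GrFrame Λ P N (fun i : Fin n × (Σ d : D, Fin (n' d) × V) => i.2.2.2) :=
    { p := fun i => op (a i.2.1 i.2.2.1 * Λ.vtx i.2.2.2) • p i.1 i.2.1
      f := fun i => LinearMap.mulLeft Lᵐᵒᵖ (Λ.vtx i.2.2.2 * b i.2.1 i.2.2.1) ∘ₗ f i.1 i.2.1
      p_mem := fun i => by
        have := P.smul_mem (hp i.1 i.2.1)
          (SetLike.mul_mem_graded (ha i.2.1 i.2.2.1) (Λ.vtx_mem i.2.2.2))
        rwa [add_zero, add_sub_cancel] at this
      f_mem := fun i k x hx => by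
        have := SetLike.mul_mem_graded (SetLike.mul_mem_graded (Λ.vtx_mem i.2.2.2)
          (hb i.2.1 i.2.2.1)) (hf i.1 i.2.1 k x hx)
        rwa [show 0 + (i.2.1 - N) + (k - i.2.1) = k - N by ring] at this
      p_vtx := fun i => by
        rw [smul_smul, ← MulOpposite.op_mul, mul_assoc, Λ.vtx_mul_self]
      vtx_f := fun i x => by
        simp only [LinearMap.comp_apply, LinearMap.mulLeft_apply]
        rw [← mul_assoc, ← mul_assoc, Λ.vtx_mul_self]
      sum_eq := fun x => by
        rw [Fintype.sum_prod_type]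
        conv_rhs => rw [← hs x]
        refine Finset.sum_congr rfl fun i _ => ?_
        rw [Fintype.sum_sigma, ← Finset.sum_coe_sort D]
        refine Finset.sum_congr rfl fun d _ => ?_
        have h1 : ∑ t : Fin (n' d) × V, a d t.1 * Λ.vtx t.2 * (Λ.vtx t.2 * b d t.1 * f i d x) =
            f i d x := by
          rw [Fintype.sum_prod_type]
          calc _ = ∑ t, a d t * (∑ v, Λ.vtx v) * b d t * f i d x := by
                refine Finset.sum_congr rfl fun t _ => ?_
                simp only [Finset.mul_sum, Finset.sum_mul]
                refine Finset.sum_congr rfl fun v _ => ?_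
                rw [← mul_assoc, ← mul_assoc, mul_assoc (a d t), Λ.vtx_mul_self]
            _ = _ := by rw [Λ.sum_vtx]; simp only [mul_one]; rw [← Finset.sum_mul, hab, one_mul]
        conv_rhs => rw [← h1, Finset.op_sum, Finset.sum_smul]
        refine Finset.sum_congr rfl fun t _ => ?_
        rw [smul_smul, ← MulOpposite.op_mul]
        rfl }
  exact ⟨N, _, _, ⟨F.reindex (Fintype.equivFin _).symm fun _ => rfl⟩⟩

variable {Λ : LeavittFamily G 𝒜} {P : GrProjModule 𝒜}

omit [GradedAlgebra 𝒜] in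
theorem exists_level {N : ℤ} {I J : Type*} [Fintype I] [Fintype J] {v : I → V} {w : J → V}
    (F : GrFrame Λ P N v) (B : GrFrame Λ P N w) :
    ∃ n, ∀ i j, F.f i (B.p j) ∈ Λ.level n := by
  choose n hn using fun i j => Λ.exhaust _ (F.f_p_mem B i j)
  refine ⟨Finset.univ.sup fun ij : I × J => n ij.1 ij.2, fun i j => Λ.level_mono ?_ (hn i j)⟩
  exact Finset.le_sup (f := fun ij : I × J => n ij.1 ij.2) (Finset.mem_univ (i, j))

/-- Refining turns a coefficient `c` into products `e* c f`, which lie one level lower. -/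
theorem exists_level_zero (n : ℕ) : ∀ {N : ℤ} {m : ℕ} {v : Fin m → V} (F : GrFrame Λ P N v),
    (∀ i j, F.f i (F.p j) ∈ Λ.level n) → ∃ (N' : ℤ) (m' : ℕ) (v' : Fin m' → V)
      (F' : GrFrame Λ P N' v'), ∀ i j, F'.f i (F'.p j) ∈ Λ.level 0 := by
  induction n with
  | zero => exact fun F h => ⟨_, _, _, F, h⟩
  | succ n ih =>
    refine fun F h => ih (F.refine.reindex (Fintype.equivFin _).symm fun _ => rfl) fun i j => ?_
    refine (refine_f_refine_p F F _ _).symm ▸ Λ.ghost_mul_edge_mem_level (h _ _) _ _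

omit [GradedAlgebra 𝒜] in
/-- Elimination of redundant generators. -/
theorem exists_basis_of_level_zero (n : ℕ) : ∀ {N : ℤ} {I : Type} [Fintype I] {v : I → V}
    (F : GrFrame Λ P N v), Fintype.card I = n → (∀ i j, F.f i (F.p j) ∈ Λ.level 0) →
    ∃ (m : ℕ) (w : Fin m → V) (B : GrFrame Λ P N w), B.IsBasis := by
  classical
  induction n with
  | zero =>
    intro N I _ v F hI _
    have := Fintype.card_eq_zero_iff.1 hI
    exact ⟨_, _, F.reindex (Fintype.equivFin I).symm fun _ => rfl,
      IsBasis.reindex ⟨fun i => isEmptyElim i, fun i => isEmptyElim i⟩ _ _⟩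
  | succ n ih =>
    intro N I _ v F hI h
    by_cases hF : ∀ i j, F.f i (F.p j) = if i = j then Λ.vtx (v i) else 0
    · refine ⟨_, _, F.reindex (Fintype.equivFin I).symm fun _ => rfl,
        IsBasis.reindex ⟨fun i => ?_, fun i j hij => ?_⟩ _ _⟩
      · simp [hF]
      · simp [hF, hij]
    push Not at hF
    obtain ⟨i₀, j₀, h₀⟩ := hF
    choose c hc hc' using fun i j => Λ.exists_coeff (h i j) (F.vtx_f i _) (F.f_p_mul_vtx F i j)
    -- The column `j₀` of `c - 1`. Expanding `p j₀` in the generators turns it into a linear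
    -- relation among them, and it is nonzero at `i₀` by the choice of `i₀` and `j₀`.
    let γ : I → K := fun i => c i j₀ - if i = j₀ then 1 else 0
    have hγ₀ : γ i₀ ≠ 0 := by
      intro h
      apply h₀
      rw [hc, sub_eq_zero.1 h]
      split_ifs <;> simp
    have hγ : ∀ i, v i ≠ v j₀ → γ i = 0 := by
      intro i hi
      have : i ≠ j₀ := fun h => hi (h ▸ rfl)
      simp [γ, hc' i j₀ hi, this]
    have hv₀ : v i₀ = v j₀ := by
      by_contra h
      exact hγ₀ (hγ _ h)
    have hrel : ∑ i, op (γ i • Λ.vtx (v i)) • F.p i = 0 := by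
      have h1 := F.sum_eq (F.p j₀)
      simp only [hc] at h1
      simp only [γ, sub_smul, MulOpposite.op_sub, Finset.sum_sub_distrib]
      rw [h1, Finset.sum_eq_single j₀]
      · simp [F.p_vtx]
      · intro i _ hi
        simp [hi]
      · simp
    -- The relation is solved for `p i₀`.
    let t : I → K := fun i => -(γ i₀)⁻¹ * γ i
    have ht : ∀ i, v i ≠ v i₀ → t i = 0 := fun i hi => by simp [t, hγ i (hv₀ ▸ hi)]
    have hrel' : ∑ i : {i // i ≠ i₀}, op (t i • Λ.vtx (v i)) • F.p i = F.p i₀ := by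
      have h1 := congrArg (fun x => op (algebraMap K L (-(γ i₀)⁻¹)) • x) hrel
      simp only [Finset.smul_sum, smul_smul, ← MulOpposite.op_mul, smul_zero] at h1
      rw [Fintype.sum_eq_add_sum_subtype_ne _ i₀] at h1
      have h2 : ∀ i, γ i • Λ.vtx (v i) * algebraMap K L (-(γ i₀)⁻¹) = t i • Λ.vtx (v i) := by
        intro i
        rw [← Algebra.commutes, ← Algebra.smul_def, smul_smul]
      simp only [h2] at h1
      have h3 : t i₀ = -1 := by simp [t, hγ₀]
      rw [h3, neg_smul, one_smul, MulOpposite.op_neg, neg_smul, F.p_vtx] at h1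
      exact (neg_add_eq_zero.1 h1).symm
    -- Substituting for `p i₀` passes its coordinate on to the others. The frame stays supported at
    -- its vertices since `t i` vanishes unless `v i = v i₀`.
    let F' : GrFrame Λ P N (fun i : {i // i ≠ i₀} => v i) :=
      { p := fun i => F.p i
        f := fun i => F.f i + t i • F.f i₀
        p_mem := fun i => F.p_mem i
        f_mem := fun i k x hx => add_mem (F.f_mem _ k x hx)
          (Submodule.smul_mem _ _ (F.f_mem _ k x hx))
        p_vtx := fun i => F.p_vtx i
        vtx_f := fun i x => by
          by_cases hi : v i = v i₀
          · simp only [LinearMap.add_apply, LinearMap.smul_apply, mul_add, F.vtx_f, mul_smul_comm]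
            rw [hi, F.vtx_f]
          · simp [ht i hi, F.vtx_f]
        sum_eq := fun x => by
          conv_rhs => rw [← F.sum_eq x, Fintype.sum_eq_add_sum_subtype_ne _ i₀, ← hrel']
          rw [Finset.smul_sum, ← Finset.sum_add_distrib]
          refine Finset.sum_congr rfl fun i _ => ?_
          rw [smul_smul, ← MulOpposite.op_mul, LinearMap.add_apply, MulOpposite.op_add, add_smul,
            add_comm, LinearMap.smul_apply]
          congr 3
          by_cases hi : v i = v i₀
          · rw [smul_mul_assoc, hi, F.vtx_f]
          · simp [ht i hi] }
    refine ih F' ?_ fun i j => ?_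
    · rw [Fintype.card_subtype_compl, hI]
      simp
    · rw [Λ.mem_level_zero]
      exact add_mem (Λ.mem_level_zero.1 (h _ _))
        (Submodule.smul_mem _ _ (Λ.mem_level_zero.1 (h _ _)))

/-- Every graded finitely generated projective module has a basis. -/
theorem exists_basis (Λ : LeavittFamily G 𝒜) (P : GrProjModule 𝒜) :
    ∃ (N : ℤ) (m : ℕ) (v : Fin m → V) (F : GrFrame Λ P N v), F.IsBasis := by
  obtain ⟨N, m, v, ⟨F⟩⟩ := exists_frame Λ P
  obtain ⟨n, hn⟩ := F.exists_level F
  obtain ⟨N', m', v', F', h⟩ := exists_level_zero n F hn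
  exact ⟨N', exists_basis_of_level_zero _ F' rfl h⟩

end GrFrame

end Bases

/-! ### Counting generators at each vertex -/

section LabelCount

variable {V E : Type*} [Fintype V] [Fintype E] [DecidableEq V] {I J : Type*} [Fintype I] [Fintype J]

/-- The number of indices with a given label. -/
def labelCount (v : I → V) (u : V) : ℕ := ∑ i, if v i = u then 1 else 0

omit [Fintype V] in
theorem labelCount_eq_card (v : I → V) (u : V) : labelCount v u = Fintype.card {i // v i = u} := by
  rw [labelCount, Fintype.card_subtype, Finset.card_filter]

omit [Fintype V] in
theorem labelCount_comp (v : I → V) (e : J ≃ I) : labelCount (v ∘ e) = labelCount v :=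
  funext fun u => Equiv.sum_comp e fun i => if v i = u then 1 else 0

omit [Fintype V] in
theorem labelCount_sum (v : I → V) (w : J → V) :
    labelCount (Sum.elim v w) = labelCount v + labelCount w :=
  funext fun _ => Fintype.sum_sum_type _

omit [Fintype V] in
theorem exists_equiv_of_labelCount_eq {v : I → V} {w : J → V} (h : labelCount v = labelCount w) :
    ∃ e : J ≃ I, ∀ j, v (e j) = w j := by
  have h' : ∀ u, Nonempty ({j // w j = u} ≃ {i // v i = u}) := fun u =>
    ⟨Fintype.equivOfCardEq (by rw [← labelCount_eq_card, ← labelCount_eq_card, h])⟩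
  refine ⟨(Equiv.sigmaFiberEquiv w).symm.trans
    ((Equiv.sigmaCongrRight fun u => (h' u).some).trans (Equiv.sigmaFiberEquiv v)), fun j => ?_⟩
  exact ((h' (w j)).some ⟨j, rfl⟩).2

/-- A generator at `u` is replaced by one generator at `r(e)` for each edge `e` leaving `u`, hence
by `A u w` generators at `w`. -/
theorem labelCount_refine (G : DirectedGraph V E) (v : I → V) :
    labelCount (fun i : (Σ i, {e // G.s e = v i}) => G.r i.2) =
      Matrix.vecMul (labelCount v) G.adjMatrix := by
  funext w
  rw [labelCount, Fintype.sum_sigma, Matrix.vecMul, dotProduct]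
  simp only [labelCount, Finset.sum_mul, ite_mul, one_mul, zero_mul]
  rw [Finset.sum_comm]
  refine Finset.sum_congr rfl fun i _ => ?_
  rw [Finset.sum_ite_eq, if_pos (Finset.mem_univ _), DirectedGraph.adjMatrix,
    Finset.card_filter, ← Finset.sum_subtype (Finset.univ.filter fun e => G.s e = v i) (by simp)
      fun e => if G.r e = w then 1 else 0, Finset.sum_filter]
  exact Finset.sum_congr rfl fun e _ => (ite_and _ _ _ _).symm

end LabelCount

theorem DirectSum.isInternal_of_projections {M : Type*} [AddCommGroup M] {C : ℤ → AddSubgroup M}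
    (π : ℤ → M →+ M) (mem : ∀ k x, π k x ∈ C k) (same : ∀ k, ∀ x ∈ C k, π k x = x)
    (ne : ∀ k l, k ≠ l → ∀ x ∈ C k, π l x = 0)
    (sum : ∀ x, ∃ S : Finset ℤ, ∑ k ∈ S, π k x = x) : DirectSum.IsInternal C := by
  constructor
  · rw [injective_iff_map_eq_zero]
    intro z hz
    refine DFinsupp.ext fun k => Subtype.ext ?_
    have h : (π k).comp (DirectSum.coeAddMonoidHom C) =
        (C k).subtype.comp (DFinsupp.evalAddMonoidHom k) := by
      refine DirectSum.addHom_ext' fun l => AddMonoidHom.ext fun x => ?_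
      simp only [AddMonoidHom.comp_apply, DirectSum.coeAddMonoidHom_of]
      by_cases hkl : l = k
      · subst hkl
        rw [same l x x.2]
        exact congrArg _ (DirectSum.of_eq_same (β := fun i => C i) l x).symm
      · rw [ne l k hkl x x.2]
        exact (congrArg (C k).subtype
          (DirectSum.of_eq_of_ne (β := fun i => C i) l k x (Ne.symm hkl))).symm
    have := DFunLike.congr_fun h z
    simp only [AddMonoidHom.comp_apply, hz, map_zero] at this
    exact this.symm
  · intro x
    obtain ⟨S, hS⟩ := sum x
    refine ⟨∑ k ∈ S, DirectSum.of (fun i => C i) k ⟨π k x, mem k x⟩, ?_⟩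
    rw [map_sum]
    simp only [DirectSum.coeAddMonoidHom_of]
    exact hS

/-! ### Dimension vectors and their uniqueness up to powers of the adjacency matrix -/

section Dimension

variable {K : Type*} [Field K] {V E : Type*} [Fintype V] [Fintype E] [DecidableEq V]
  [DecidableEq E] {G : DirectedGraph V E} {L : Type u} [Ring L] [Algebra K L]
  {𝒜 : ℤ → Submodule K L} [GradedAlgebra 𝒜]

namespace LeavittFamily

variable (Λ : LeavittFamily G 𝒜) (v : V)

omit [GradedAlgebra 𝒜] in
/-- The right ideal generated by a vertex. -/
def ideal : Submodule Lᵐᵒᵖ L where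
  carrier := {x | Λ.vtx v * x = x}
  add_mem' {x y} hx hy := by
    change _ * (x + y) = _
    rw [mul_add, hx, hy]
  zero_mem' := mul_zero _
  smul_mem' a x hx := by
    induction a using MulOpposite.rec' with | _ a =>
    change _ * (x * a) = x * a
    rw [← mul_assoc, hx]

omit [GradedAlgebra 𝒜] in
theorem mem_ideal {x : L} : x ∈ Λ.ideal v ↔ Λ.vtx v * x = x := Iff.rfl

omit [GradedAlgebra 𝒜] in
/-- The generating map onto the right ideal of a vertex. -/
def toIdeal : Lᵐᵒᵖ →ₗ[Lᵐᵒᵖ] Λ.ideal v where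
  toFun a := ⟨Λ.vtx v * a.unop, by rw [mem_ideal, ← mul_assoc, Λ.vtx_mul_self]⟩
  map_add' a b := Subtype.ext (mul_add _ _ _)
  map_smul' a b := Subtype.ext (mul_assoc _ _ _).symm

omit [GradedAlgebra 𝒜] in
/-- The inclusion of the right ideal of a vertex. -/
def ofIdeal : Λ.ideal v →ₗ[Lᵐᵒᵖ] Lᵐᵒᵖ where
  toFun x := op x
  map_add' _ _ := rfl
  map_smul' _ _ := rfl

omit [GradedAlgebra 𝒜] in
theorem toIdeal_comp_ofIdeal : Λ.toIdeal v ∘ₗ Λ.ofIdeal v = LinearMap.id :=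
  LinearMap.ext fun x => Subtype.ext x.2

/-- The graded right module generated by a vertex. -/
def vtxModule : GrProjModule 𝒜 where
  carrier := Λ.ideal v
  component i := (𝒜 i).toAddSubgroup.comap (Λ.ideal v).subtype.toAddMonoidHom
  isInternal := by
    classical
    -- A vertex has degree zero, so multiplying by it commutes with taking components.
    have hmem : ∀ k, ∀ x ∈ Λ.ideal v, GradedRing.proj 𝒜 k x ∈ Λ.ideal v := fun k x hx => by
      rw [mem_ideal, GradedRing.proj_apply,
        ← DirectSum.coe_decompose_mul_of_left_mem_zero 𝒜 (Λ.vtx_mem v), (Λ.mem_ideal v).1 hx]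
    refine DirectSum.isInternal_of_projections (fun k => AddMonoidHom.mk' (fun x : Λ.ideal v =>
      (⟨GradedRing.proj 𝒜 k x, hmem k x x.2⟩ : Λ.ideal v)) fun x y =>
        Subtype.ext (map_add _ _ _)) (fun k x => ?_) (fun k x hx => ?_) (fun k l hkl x hx => ?_)
        fun x => ⟨(DirectSum.decompose 𝒜 (x : L)).support, ?_⟩
    · exact (DirectSum.decompose 𝒜 (x : L) k).2
    · exact Subtype.ext (DirectSum.decompose_of_mem_same 𝒜 hx)
    · exact Subtype.ext (DirectSum.decompose_of_mem_ne 𝒜 hx hkl)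
    · refine Subtype.ext ?_
      rw [AddSubmonoidClass.coe_finsetSum]
      exact DirectSum.sum_support_decompose 𝒜 (x : L)
  smul_mem hx ha := SetLike.mul_mem_graded (A := 𝒜) hx ha
  finite := Module.Finite.of_surjective (Λ.toIdeal v)
    fun x => ⟨Λ.ofIdeal v x, DFunLike.congr_fun (Λ.toIdeal_comp_ofIdeal v) x⟩
  projective := Module.Projective.of_split _ _ (Λ.toIdeal_comp_ofIdeal v)

/-- The tautological basis of the module generated by a vertex. -/
def vtxFrame : GrFrame Λ (Λ.vtxModule v) 0 (fun _ : Unit => v) where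
  p _ := (⟨Λ.vtx v, Λ.vtx_mul_self v⟩ : Λ.ideal v)
  f _ := (Λ.ideal v).subtype
  p_mem _ := Λ.vtx_mem v
  f_mem _ k x hx := by
    rw [sub_zero]
    exact hx
  p_vtx _ := Subtype.ext (Λ.vtx_mul_self v)
  vtx_f _ x := x.2
  sum_eq x := by
    rw [Fintype.sum_unique]
    exact Subtype.ext x.2

theorem vtxFrame_isBasis : (Λ.vtxFrame v).IsBasis :=
  ⟨fun _ => rfl, fun _ _ h => absurd rfl h⟩

end LeavittFamily

/-- `P` has a basis of degree `N` with `a u` elements at each vertex `u`. -/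
def HasDimension (Λ : LeavittFamily G 𝒜) (P : GrProjModule 𝒜) (N : ℤ) (a : V → ℕ) : Prop :=
  ∃ (m : ℕ) (v : Fin m → V) (F : GrFrame Λ P N v), F.IsBasis ∧ labelCount v = a

namespace HasDimension

variable {Λ : LeavittFamily G 𝒜} {P Q : GrProjModule 𝒜} {N : ℤ} {a b : V → ℕ}

omit [GradedAlgebra 𝒜] in
theorem of_isBasis {I : Type*} [Fintype I] {v : I → V} {F : GrFrame Λ P N v} (hF : F.IsBasis) :
    HasDimension Λ P N (labelCount v) :=
  ⟨_, _, F.reindex (Fintype.equivFin I).symm fun _ => rfl, hF.reindex _ _, labelCount_comp _ _⟩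

variable (Λ P) in
theorem exists_hasDimension : ∃ N a, HasDimension Λ P N a := by
  obtain ⟨N, m, v, F, hF⟩ := GrFrame.exists_basis Λ P
  exact ⟨N, _, of_isBasis hF⟩

omit [GradedAlgebra 𝒜] in
theorem grIso (hP : HasDimension Λ P N a) (hQ : HasDimension Λ Q N a) :
    GrProjModule.GrIso P Q := by
  obtain ⟨m, v, F, hF, rfl⟩ := hP
  obtain ⟨m', w, B, hB, h⟩ := hQ
  obtain ⟨e, he⟩ := exists_equiv_of_labelCount_eq h
  exact F.grIso (B.reindex e he) hF (hB.reindex _ _)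

omit [GradedAlgebra 𝒜] in
theorem of_grIso (hP : HasDimension Λ P N a) (h : GrProjModule.GrIso P Q) :
    HasDimension Λ Q N a := by
  obtain ⟨m, v, F, hF, rfl⟩ := hP
  obtain ⟨B, hB⟩ := F.exists_of_grIso hF h
  exact ⟨_, _, B, hB, rfl⟩

omit [GradedAlgebra 𝒜] in
theorem prod (hP : HasDimension Λ P N a) (hQ : HasDimension Λ Q N b) :
    HasDimension Λ (P.prod Q) N (a + b) := by
  obtain ⟨m, v, F, hF, rfl⟩ := hP
  obtain ⟨m', w, B, hB, rfl⟩ := hQ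
  exact labelCount_sum v w ▸ of_isBasis (hF.prod hB)

omit [GradedAlgebra 𝒜] in
theorem shift (hP : HasDimension Λ P N a) (k : ℤ) : HasDimension Λ (P.shift k) (N - k) a := by
  obtain ⟨m, v, F, hF, rfl⟩ := hP
  exact ⟨_, _, F.shift k, hF, rfl⟩

theorem refine (hP : HasDimension Λ P N a) :
    HasDimension Λ P (N + 1) (Matrix.vecMul a G.adjMatrix) := by
  obtain ⟨m, v, F, hF, rfl⟩ := hP
  exact labelCount_refine G v ▸ of_isBasis hF.refine

theorem refine_pow (hP : HasDimension Λ P N a) (n : ℕ) :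
    HasDimension Λ P (N + n) (Matrix.vecMul a (G.adjMatrix ^ n)) := by
  induction n with
  | zero => simpa using hP
  | succ n ih =>
    have := ih.refine
    rw [Matrix.vecMul_vecMul, ← pow_succ] at this
    simpa [add_assoc] using this

theorem vtxModule (Λ : LeavittFamily G 𝒜) (v : V) :
    HasDimension Λ (Λ.vtxModule v) 0 (Pi.single v 1) := by
  have := of_isBasis (Λ.vtxFrame_isBasis v)
  convert this using 1
  funext u
  simp [labelCount, Pi.single_apply, eq_comm]

omit [GradedAlgebra 𝒜] in
theorem zero (Λ : LeavittFamily G 𝒜) : HasDimension Λ (GrProjModule.zero (𝒜 := 𝒜)) 0 0 :=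
  ⟨0, Fin.elim0, ⟨fun i => i.elim0, fun i => i.elim0, fun i => i.elim0, fun i => i.elim0,
    fun i => i.elim0, fun i => i.elim0, fun _ => rfl⟩, ⟨fun i => i.elim0, fun i => i.elim0⟩, rfl⟩

-- At each vertex `u` the two change-of-basis matrices are inverse to each other over `K`. Terms
-- through other vertices vanish, and scalars can be compared because vertices are nonzero.
omit [GradedAlgebra 𝒜] in
theorem coeff_mul_coeff {I J : Type*} [Fintype I] [Fintype J] [DecidableEq I] {v : I → V}
    {w : J → V} {F : GrFrame Λ P N v} {B : GrFrame Λ P N w} (hF : F.IsBasis) {c : I → J → K}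
    {d : J → I → K} (hc : ∀ i j, F.f i (B.p j) = c i j • Λ.vtx (v i))
    (hc₀ : ∀ i j, v i ≠ w j → c i j = 0)
    (hd : ∀ j i, B.f j (F.p i) = d j i • Λ.vtx (w j)) (u : V) :
    Matrix.of (fun (i : {i // v i = u}) (j : {j // w j = u}) => c i j) *
      Matrix.of (fun (j : {j // w j = u}) (i : {i // v i = u}) => d j i) = 1 := by
  ext ⟨i, hi⟩ ⟨i', hi'⟩
  simp only [Matrix.mul_apply, Matrix.of_apply]
  rw [← Finset.sum_subtype (Finset.univ.filter fun j => w j = u) (by simp)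
    fun j => c i j * d j i', Finset.sum_filter]
  apply Λ.smul_vtx_injective (v i)
  have h1 : ∀ j, (if w j = u then c i j * d j i' else 0) • Λ.vtx (v i) =
      F.f i (B.p j) * B.f j (F.p i') := by
    intro j
    rw [hc, hd]
    split_ifs with hj
    · rw [smul_mul_smul_comm, hi, hj, Λ.vtx_mul_self]
    · rw [hc₀ i j fun h => hj (h.symm.trans hi)]
      simp
  dsimp only
  rw [Finset.sum_smul, Finset.sum_congr rfl fun j _ => h1 j, B.sum_f_mul_f, Matrix.one_apply]
  by_cases h : i = i'
  · subst h
    simp [hF.1]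
  · rw [if_neg fun h' => h (congrArg Subtype.val h'), zero_smul, hF.2 i i' h]

-- For each vertex the scalar change-of-basis matrix is invertible, hence square.
omit [GradedAlgebra 𝒜] in
theorem labelCount_eq_of_level_zero {I J : Type*} [Fintype I] [Fintype J] {v : I → V} {w : J → V}
    {F : GrFrame Λ P N v} {B : GrFrame Λ P N w} (hF : F.IsBasis) (hB : B.IsBasis)
    (h : ∀ i j, F.f i (B.p j) ∈ Λ.level 0) (h' : ∀ j i, B.f j (F.p i) ∈ Λ.level 0) :
    labelCount v = labelCount w := by
  classical
  choose c hc hc₀ using fun i j => Λ.exists_coeff (h i j) (F.vtx_f i _) (F.f_p_mul_vtx B i j)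
  choose d hd hd₀ using fun j i => Λ.exists_coeff (h' j i) (B.vtx_f j _) (B.f_p_mul_vtx F j i)
  funext u
  rw [labelCount_eq_card, labelCount_eq_card]
  exact Matrix.square_of_invertible _ _ (coeff_mul_coeff hF hc hc₀ hd u)
    (coeff_mul_coeff hB hd hd₀ hc u)

/-- Both bases are refined simultaneously until their mutual coefficients reach level zero; each
refinement multiplies both vectors by the adjacency matrix. -/
theorem exists_vecMul_pow_eq (hP : HasDimension Λ P N a) (hQ : HasDimension Λ P N b) :
    ∃ n : ℕ, Matrix.vecMul a (G.adjMatrix ^ n) = Matrix.vecMul b (G.adjMatrix ^ n) := by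
  obtain ⟨m, v, F, hF, rfl⟩ := hP
  obtain ⟨m', w, B, hB, rfl⟩ := hQ
  obtain ⟨n₁, h₁⟩ := F.exists_level B
  obtain ⟨n₂, h₂⟩ := B.exists_level F
  have h : ∀ i j, F.f i (B.p j) ∈ Λ.level (max n₁ n₂) := fun i j =>
    Λ.level_mono (le_max_left _ _) (h₁ i j)
  have h' : ∀ i j, B.f i (F.p j) ∈ Λ.level (max n₁ n₂) := fun i j =>
    Λ.level_mono (le_max_right _ _) (h₂ i j)
  refine ⟨max n₁ n₂, ?_⟩
  generalize max n₁ n₂ = n at h h'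
  clear h₁ h₂
  induction n generalizing N m m' with
  | zero => simpa using labelCount_eq_of_level_zero hF hB h h'
  | succ n ih =>
    have := ih _ _ _ (hF.refine.reindex (Fintype.equivFin _).symm fun _ => rfl) _ _ _
      (hB.refine.reindex (Fintype.equivFin _).symm fun _ => rfl)
      (fun i j => (GrFrame.refine_f_refine_p F B _ _).symm ▸ Λ.ghost_mul_edge_mem_level (h _ _) _ _)
      (fun i j => (GrFrame.refine_f_refine_p B F _ _).symm ▸
        Λ.ghost_mul_edge_mem_level (h' _ _) _ _)
    have e₁ := labelCount_comp (fun i : (Σ i, {e // G.s e = v i}) => G.r i.2)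
      (Fintype.equivFin _).symm
    have e₂ := labelCount_comp (fun i : (Σ i, {e // G.s e = w i}) => G.r i.2)
      (Fintype.equivFin _).symm
    rw [labelCount_refine] at e₁ e₂
    rw [pow_succ', ← Matrix.vecMul_vecMul, ← Matrix.vecMul_vecMul, ← e₁, ← e₂]
    exact this

end HasDimension

end Dimension

/-! ### Classes in the graded Grothendieck group -/

section Classes

variable {K : Type*} [Field K] {V E : Type*} [Fintype V] [Fintype E] [DecidableEq V]
  [DecidableEq E] {G : DirectedGraph V E} {L : Type u} [Ring L] [Algebra K L]
  {𝒜 : ℤ → Submodule K L} [GradedAlgebra 𝒜] (Λ : LeavittFamily G 𝒜)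

theorem K0gr.of_mk_eq_iff {A : Type u} [Ring A] {σ : Type v} [SetLike σ A] {𝒜 : ℤ → σ}
    {P Q : GrProjModule 𝒜} : K0gr.of 𝒜 (Vgr.mk P) = K0gr.of 𝒜 (Vgr.mk Q) ↔
      ∃ R : GrProjModule 𝒜, GrProjModule.GrIso (R.prod P) (R.prod Q) := by
  constructor
  · intro h
    obtain ⟨⟨⟨R⟩, _⟩, hR⟩ := 
      ((AddLocalization.addMonoidOf (⊤ : AddSubmonoid (Vgr 𝒜))).eq_iff_exists).1 h
    exact ⟨R, Quotient.exact hR⟩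
  · rintro ⟨R, hR⟩
    have : Vgr.mk R + Vgr.mk P = Vgr.mk R + Vgr.mk Q := Quotient.sound hR
    have := congrArg (K0gr.of 𝒜) this
    rw [map_add, map_add] at this
    exact add_left_cancel this

namespace LeavittFamily

theorem exists_grProjModule (n : ℕ) : ∀ v : Fin n → V, ∃ P : GrProjModule 𝒜,
    HasDimension Λ P 0 (labelCount v) ∧ Vgr.mk P = ∑ i, Vgr.mk (Λ.vtxModule (v i)) := by
  induction n with
  | zero =>
    exact fun v => ⟨_, HasDimension.zero Λ, rfl⟩
  | succ n ih =>
    intro v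
    obtain ⟨P, hP, h⟩ := ih fun i => v i.succ
    refine ⟨(Λ.vtxModule (v 0)).prod P, ?_, ?_⟩
    · convert (HasDimension.vtxModule Λ (v 0)).prod hP using 1
      funext u
      rw [labelCount, Fin.sum_univ_succ, Pi.add_apply, labelCount, Pi.single_apply]
      simp only [eq_comm]
    · rw [Fin.sum_univ_succ, ← h]
      rfl

theorem mk_eq_of_hasDimension {P : GrProjModule 𝒜} {a : V → ℕ} (hP : HasDimension Λ P 0 a) :
    Vgr.mk P = ∑ v, a v • Vgr.mk (Λ.vtxModule v) := by
  obtain ⟨m, v, F, hF, rfl⟩ := id hP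
  obtain ⟨Q, hQ, h⟩ := Λ.exists_grProjModule m v
  rw [show Vgr.mk P = Vgr.mk Q from Quotient.sound (hP.grIso hQ), h]
  simp only [labelCount, Finset.sum_smul, ite_smul, one_smul, zero_smul]
  rw [Finset.sum_comm]
  simp

theorem exists_hasDimension_zero (a : V → ℕ) : ∃ P : GrProjModule 𝒜, HasDimension Λ P 0 a := by
  obtain ⟨P, hP, -⟩ := Λ.exists_grProjModule _
    ((fun i : Σ v, Fin (a v) => i.1) ∘ (Fintype.equivFin _).symm)
  refine ⟨P, ?_⟩
  convert hP using 1
  rw [labelCount_comp]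
  funext u
  rw [labelCount, Fintype.sum_sigma, Finset.sum_eq_single u]
  · simp
  · intro v _ hv
    simp [hv]
  · simp

/-- The class of the module generated by a vertex. -/
noncomputable def vtxClass (v : V) : K0gr 𝒜 := K0gr.of 𝒜 (Vgr.mk (Λ.vtxModule v))

theorem of_mk_eq_of_hasDimension {P : GrProjModule 𝒜} {a : V → ℕ} (hP : HasDimension Λ P 0 a) :
    K0gr.of 𝒜 (Vgr.mk P) = ∑ v, a v • Λ.vtxClass v := by
  rw [Λ.mk_eq_of_hasDimension hP, map_sum]
  simp only [map_nsmul]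
  rfl

/-- Refining the tautological basis of `vL` once gives row `v` of the adjacency matrix in degree
`1`; the shift by `1` brings it back to degree `0`. -/
theorem T_smul_vtxClass (v : V) :
    (LaurentPolynomial.T 1 : ℤ[T;T⁻¹]) • Λ.vtxClass v = ∑ w, G.adjMatrix v w • Λ.vtxClass w := by
  have h := (HasDimension.vtxModule Λ v).refine.shift 1
  rw [zero_add, sub_self] at h
  rw [vtxClass, K0gr.T_smul_of_mk, Λ.of_mk_eq_of_hasDimension h]
  simp

theorem mem_mrange_of_iff {y : K0gr 𝒜} : y ∈ AddMonoidHom.mrange (K0gr.of 𝒜) ↔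
    ∃ (k : ℤ) (a : V → ℕ), y = (LaurentPolynomial.T k : ℤ[T;T⁻¹]) • ∑ v, a v • Λ.vtxClass v := by
  constructor
  · rintro ⟨⟨P⟩, rfl⟩
    obtain ⟨N, a, h⟩ := HasDimension.exists_hasDimension Λ P
    have h' := h.shift N
    rw [sub_self] at h'
    refine ⟨-N, a, ?_⟩
    rw [← Λ.of_mk_eq_of_hasDimension h', ← K0gr.T_smul_of_mk, smul_smul, ← LaurentPolynomial.T_add,
      neg_add_cancel, LaurentPolynomial.T_zero, one_smul]
    rfl
  · rintro ⟨k, a, rfl⟩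
    obtain ⟨P, hP⟩ := Λ.exists_hasDimension_zero a
    rw [← Λ.of_mk_eq_of_hasDimension hP, K0gr.T_smul_of_mk]
    exact ⟨_, rfl⟩

/-- Equal classes mean a graded isomorphism after adding some `R`. The vector of `R` is then
cancelled in `ℕ^V`. -/
theorem exists_vecMul_pow_eq_of_sum_eq {a b : V → ℕ}
    (h : ∑ v, a v • Λ.vtxClass v = ∑ v, b v • Λ.vtxClass v) :
    ∃ n : ℕ, Matrix.vecMul a (G.adjMatrix ^ n) = Matrix.vecMul b (G.adjMatrix ^ n) := by
  obtain ⟨P, hP⟩ := Λ.exists_hasDimension_zero a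
  obtain ⟨Q, hQ⟩ := Λ.exists_hasDimension_zero b
  rw [← Λ.of_mk_eq_of_hasDimension hP, ← Λ.of_mk_eq_of_hasDimension hQ, K0gr.of_mk_eq_iff] at h
  obtain ⟨R, hR⟩ := h
  obtain ⟨N, c, hc⟩ := HasDimension.exists_hasDimension Λ R
  have hc' := hc.refine_pow (-N).toNat
  have hP' := hP.refine_pow N.toNat
  have hQ' := hQ.refine_pow N.toNat
  -- `R` has a basis in degree `N`, the other two modules in degree `0`; all are refined to degree
  -- `max N 0`.
  rw [show 0 + (N.toNat : ℤ) = N + (-N).toNat by omega] at hP' hQ'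
  obtain ⟨n, hn⟩ := ((hc'.prod hP').of_grIso hR).exists_vecMul_pow_eq (hc'.prod hQ')
  refine ⟨N.toNat + n, ?_⟩
  rw [Matrix.add_vecMul, Matrix.add_vecMul] at hn
  have := add_left_cancel hn
  rwa [Matrix.vecMul_vecMul, Matrix.vecMul_vecMul, ← pow_add] at this

end LeavittFamily

end Classes

/-! ### Dimension modules and shift equivalence -/

section DimensionModule

open LaurentPolynomial (T)

variable {V W : Type*} [Fintype V] [DecidableEq V] [Fintype W] [DecidableEq W]
  {M N : Type*} [AddCommGroup M] [Module ℤ[T;T⁻¹] M] [AddCommGroup N] [Module ℤ[T;T⁻¹] N]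

/-- The module `M` with positive cone `C` is the dimension module of the matrix `A`: it is generated
by elements `x v` with `T x = A x`, and equality of combinations is eventual equality. -/
structure IsDimensionModule (A : Matrix V V ℕ) (C : AddSubmonoid M) (x : V → M) : Prop where
  T_smul : ∀ v, (T 1 : ℤ[T;T⁻¹]) • x v = ∑ w, A v w • x w
  mem_iff : ∀ y, y ∈ C ↔ ∃ (k : ℤ) (a : V → ℕ), y = (T k : ℤ[T;T⁻¹]) • ∑ v, a v • x v
  exists_pow : ∀ a b : V → ℕ, ∑ v, a v • x v = ∑ v, b v • x v →
    ∃ n : ℕ, Matrix.vecMul a (A ^ n) = Matrix.vecMul b (A ^ n)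
  exists_sub : ∀ y, ∃ y₁ ∈ C, ∃ y₂ ∈ C, y = y₁ - y₂

omit [DecidableEq V] [DecidableEq W] [Module ℤ[T;T⁻¹] M] in
theorem sum_vecMul_smul (a : V → ℕ) (R : Matrix V W ℕ) (y : W → M) :
    ∑ w, Matrix.vecMul a R w • y w = ∑ v, a v • ∑ w, R v w • y w := by
  simp only [Matrix.vecMul, dotProduct, Finset.sum_smul, Finset.smul_sum, mul_smul]
  exact Finset.sum_comm

theorem pow_mul_eq_mul_pow {A : Matrix V V ℕ} {B : Matrix W W ℕ} {R : Matrix V W ℕ}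
    (h : A * R = R * B) (n : ℕ) : A ^ n * R = R * B ^ n := by
  induction n with
  | zero => simp
  | succ n ih => rw [pow_succ, Matrix.mul_assoc, h, ← Matrix.mul_assoc, ih, Matrix.mul_assoc,
      ← pow_succ]

/-- Up to a power of `T`, `z` is a difference of combinations of the `x v`, and `z'` is the
difference of their images under the matrix `R`. -/
def IsRepresented (x : V → M) (R : Matrix V W ℕ) (y : W → N) (z : M) (z' : N) : Prop :=
  ∃ (n : ℕ) (a b : V → ℕ),
    (T n : ℤ[T;T⁻¹]) • z = ∑ v, a v • x v - ∑ v, b v • x v ∧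
    (T n : ℤ[T;T⁻¹]) • z' =
      ∑ w, Matrix.vecMul a R w • y w - ∑ w, Matrix.vecMul b R w • y w

namespace IsDimensionModule

variable {A : Matrix V V ℕ} {C : AddSubmonoid M} {x : V → M} {B : Matrix W W ℕ}
  {D : AddSubmonoid N} {y : W → N} (hM : IsDimensionModule A C x) (hN : IsDimensionModule B D y)

include hM

theorem T_smul_sum (n : ℕ) (a : V → ℕ) :
    (T n : ℤ[T;T⁻¹]) • ∑ v, a v • x v = ∑ v, Matrix.vecMul a (A ^ n) v • x v := by
  induction n with
  | zero => simp
  | succ n ih =>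
    rw [Nat.cast_succ, add_comm, LaurentPolynomial.T_add, mul_smul, ih, Finset.smul_sum, pow_succ,
      ← Matrix.vecMul_vecMul, sum_vecMul_smul]
    refine Finset.sum_congr rfl fun v _ => ?_
    rw [← hM.T_smul, smul_comm]

theorem T_smul_apply (n : ℕ) (v : V) :
    (T n : ℤ[T;T⁻¹]) • x v = ∑ w, (A ^ n) v w • x w := by
  have hx : x v = ∑ u, (Pi.single v 1 : V → ℕ) u • x u := by
    simp [Pi.single_apply]
  rw [hx, hM.T_smul_sum, Matrix.single_one_vecMul]
  rfl

-- There are finitely many rows, so the largest of their exponents works, and agreement persists for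
-- higher powers.
omit [DecidableEq W] in
theorem exists_pow_matrix (X Y : Matrix W V ℕ)
    (h : ∀ w, ∑ v, X w v • x v = ∑ v, Y w v • x v) :
    ∃ n : ℕ, ∀ m, n ≤ m → X * A ^ m = Y * A ^ m := by
  choose n hn using fun w => hM.exists_pow _ _ (h w)
  refine ⟨Finset.univ.sup n, fun m hm => Matrix.ext fun w v => ?_⟩
  obtain ⟨k, rfl⟩ := Nat.exists_eq_add_of_le ((Finset.le_sup (Finset.mem_univ w)).trans hm)
  have := congrArg (fun a => Matrix.vecMul a (A ^ k)) (hn w)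
  simp only [Matrix.vecMul_vecMul, ← pow_add] at this
  exact congrFun this v

theorem surjective : Function.Surjective (Fintype.linearCombination ℤ[T;T⁻¹] x) := by
  rw [← LinearMap.range_eq_top, eq_top_iff]
  have hC : ∀ z ∈ C, z ∈ LinearMap.range (Fintype.linearCombination ℤ[T;T⁻¹] x) := by
    intro z hz
    obtain ⟨k, a, rfl⟩ := (hM.mem_iff z).1 hz
    refine Submodule.smul_mem _ _ (sum_mem fun v _ => nsmul_mem ?_ _)
    rw [Fintype.range_linearCombination]
    exact Submodule.subset_span ⟨v, rfl⟩
  intro z _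
  obtain ⟨z₁, h₁, z₂, h₂, rfl⟩ := hM.exists_sub z
  exact sub_mem (hC _ h₁) (hC _ h₂)

theorem hom_ext {f g : M →ₗ[ℤ[T;T⁻¹]] N} (h : ∀ v, f (x v) = g (x v)) : f = g := by
  refine LinearMap.ext fun z => ?_
  obtain ⟨p, rfl⟩ := hM.surjective z
  simp [Fintype.linearCombination_apply, h]

theorem map_mem (f : M →ₗ[ℤ[T;T⁻¹]] N) (hf : ∀ v, f (x v) ∈ D)
    (hD : ∀ k, ∀ z ∈ D, (T k : ℤ[T;T⁻¹]) • z ∈ D) {z : M} (hz : z ∈ C) : f z ∈ D := by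
  obtain ⟨k, a, rfl⟩ := (hM.mem_iff z).1 hz
  rw [map_smul, map_sum]
  exact hD _ _ (sum_mem fun v _ => by rw [map_nsmul]; exact nsmul_mem (hf v) _)

theorem T_smul_mem (k : ℤ) {z : M} (hz : z ∈ C) : (T k : ℤ[T;T⁻¹]) • z ∈ C := by
  obtain ⟨l, a, rfl⟩ := (hM.mem_iff z).1 hz
  exact (hM.mem_iff _).2 ⟨k + l, a, by rw [LaurentPolynomial.T_add, mul_smul]⟩

theorem sum_mem_cone (a : V → ℕ) : ∑ v, a v • x v ∈ C :=
  (hM.mem_iff _).2 ⟨0, a, by simp⟩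

include hN

/-- Both representations are brought to the exponent `n + m`. This costs powers of `A` on one side
and of `B` on the other, which `A * R = R * B` reconciles. -/
theorem isRepresented_add {R : Matrix V W ℕ} (hR : A * R = R * B) {z₁ z₂ : M} {z₁' z₂' : N}
    (h : IsRepresented x R y z₁ z₁') (h' : IsRepresented x R y z₂ z₂') :
    IsRepresented x R y (z₁ + z₂) (z₁' + z₂') := by
  obtain ⟨n, a, b, h₁, h₂⟩ := h
  obtain ⟨m, c, d, h₃, h₄⟩ := h'
  refine ⟨n + m, Matrix.vecMul a (A ^ m) + Matrix.vecMul c (A ^ n),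
    Matrix.vecMul b (A ^ m) + Matrix.vecMul d (A ^ n), ?_, ?_⟩
  · simp only [Pi.add_apply, add_smul, Finset.sum_add_distrib, smul_add]
    rw [Nat.cast_add, LaurentPolynomial.T_add, mul_smul, mul_smul, h₃, smul_comm, h₁, smul_sub,
      smul_sub, hM.T_smul_sum, hM.T_smul_sum, hM.T_smul_sum, hM.T_smul_sum]
    abel
  · simp only [Pi.add_apply, add_smul, Finset.sum_add_distrib, smul_add, Matrix.add_vecMul]
    rw [Nat.cast_add, LaurentPolynomial.T_add, mul_smul, mul_smul, h₄, smul_comm, h₂, smul_sub,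
      smul_sub, hN.T_smul_sum, hN.T_smul_sum, hN.T_smul_sum, hN.T_smul_sum]
    simp only [Matrix.vecMul_vecMul, pow_mul_eq_mul_pow hR]
    abel

theorem isRepresented_smul {R : Matrix V W ℕ} (hR : A * R = R * B) (v : V) (p : ℤ[T;T⁻¹]) :
    IsRepresented x R y (p • x v) (p • ∑ w, R v w • y w) := by
  induction p using LaurentPolynomial.induction_on' with
  | add p q hp hq =>
    rw [add_smul, add_smul]
    exact isRepresented_add hM hN hR hp hq
  | C_mul_T k c =>
    have hT : (T ((-k).toNat : ℤ) * T k : ℤ[T;T⁻¹]) = T (k.toNat : ℤ) := by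
      rw [← LaurentPolynomial.T_add]
      congr 1
      omega
    have hx : x v = ∑ u, (Pi.single v 1 : V → ℕ) u • x u := by
      simp [Pi.single_apply]
    have hRv : R v = Matrix.vecMul (Pi.single v 1) R := by
      rw [Matrix.single_one_vecMul]
      rfl
    -- Coefficient vectors are natural, so the integer is split into a difference; a negative power
    -- of `T` is cleared by the exponent `(-k).toNat`.
    obtain ⟨i, j, rfl⟩ : ∃ i j : ℕ, c = i - j := ⟨c.toNat, (-c).toNat, by omega⟩
    refine ⟨(-k).toNat, i • Matrix.vecMul (Pi.single v 1) (A ^ k.toNat),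
      j • Matrix.vecMul (Pi.single v 1) (A ^ k.toNat), ?_, ?_⟩
    · rw [← LaurentPolynomial.smul_eq_C_mul, smul_assoc, smul_comm, smul_smul, hT, hx,
        hM.T_smul_sum, sub_smul]
      simp only [natCast_zsmul, Pi.smul_apply, smul_eq_mul, mul_smul, Finset.smul_sum]
    · rw [← LaurentPolynomial.smul_eq_C_mul, smul_assoc, smul_comm, smul_smul, hT, hRv,
        hN.T_smul_sum, sub_smul, Matrix.vecMul_vecMul, ← pow_mul_eq_mul_pow hR]
      simp only [natCast_zsmul, Pi.smul_apply, smul_eq_mul, mul_smul, Finset.smul_sum,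
        Matrix.smul_vecMul, Matrix.vecMul_vecMul]

theorem isRepresented_sum {R : Matrix V W ℕ} (hR : A * R = R * B) (p : V → ℤ[T;T⁻¹]) :
    IsRepresented x R y (∑ v, p v • x v) (∑ v, p v • ∑ w, R v w • y w) := by
  refine Finset.induction_on (motive := fun s : Finset V => IsRepresented x R y (∑ v ∈ s, p v • x v)
    (∑ v ∈ s, p v • ∑ w, R v w • y w)) Finset.univ ⟨0, 0, 0, by simp, by simp⟩ fun v s hv h => ?_
  rw [Finset.sum_insert hv, Finset.sum_insert hv]
  exact isRepresented_add hM hN hR (hM.isRepresented_smul hN hR v _) h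

/-- An intertwining matrix induces a homomorphism of dimension modules. -/
theorem exists_hom {R : Matrix V W ℕ} (hR : A * R = R * B) :
    ∃ f : M →ₗ[ℤ[T;T⁻¹]] N, ∀ v, f (x v) = ∑ w, R v w • y w := by
  let π := Fintype.linearCombination ℤ[T;T⁻¹] x
  let ψ := Fintype.linearCombination ℤ[T;T⁻¹] fun v => ∑ w, R v w • y w
  have hT : ∀ (n : ℤ) {z : N}, (T n : ℤ[T;T⁻¹]) • z = 0 → z = 0 := fun n z h => by
    have : (T (-n) : ℤ[T;T⁻¹]) • (T n : ℤ[T;T⁻¹]) • z = (T (-n) : ℤ[T;T⁻¹]) • 0 := by rw [h]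
    rwa [smul_zero, smul_smul, ← LaurentPolynomial.T_add, neg_add_cancel, LaurentPolynomial.T_zero,
      one_smul] at this
  -- After multiplication by a power of `T`, a relation among the `x v` equates two natural
  -- combinations, so their vectors agree after some `A ^ m`. Multiplying by `R` carries this over
  -- to the `y w`, where powers of `T` cancel.
  have hker : LinearMap.ker π ≤ LinearMap.ker ψ := by
    intro p hp
    rw [LinearMap.mem_ker] at hp ⊢
    obtain ⟨n, a, b, h₁, h₂⟩ := hM.isRepresented_sum hN hR p
    rw [show ∑ v, p v • x v = 0 from hp, smul_zero, eq_comm, sub_eq_zero] at h₁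
    obtain ⟨m, hm⟩ := hM.exists_pow _ _ h₁
    refine hT n (h₂.trans (hT m ?_))
    rw [smul_sub, hN.T_smul_sum, hN.T_smul_sum, Matrix.vecMul_vecMul, Matrix.vecMul_vecMul,
      ← pow_mul_eq_mul_pow hR,
      ← Matrix.vecMul_vecMul, ← Matrix.vecMul_vecMul, hm, sub_self]
  refine ⟨(LinearMap.ker π).liftQ ψ hker ∘ₗ (π.quotKerEquivOfSurjective hM.surjective).symm,
    fun v => ?_⟩
  have h : π (Pi.single v 1) = x v := by simp [π]
  rw [← h]
  simp [ψ, LinearMap.quotKerEquivOfSurjective_symm_apply]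

/-- `R` and `S` induce maps preserving the cones, with both composites equal to the invertible `T
l`. As `T (-l)` preserves the cone as well, so does the inverse `T (-l) • g`. -/
theorem exists_equiv_of_shiftEquivalent (h : Matrix.ShiftEquivalent A B) :
    ∃ f : M ≃ₗ[ℤ[T;T⁻¹]] N, ∀ z, f z ∈ D ↔ z ∈ C := by
  obtain ⟨l, R, S, -, hA, hB, hR, hS⟩ := h
  obtain ⟨f, hf⟩ := hM.exists_hom hN hR
  obtain ⟨g, hg⟩ := hN.exists_hom hM hS.symm
  have hgf : g ∘ₗ f = (T l : ℤ[T;T⁻¹]) • LinearMap.id := hM.hom_ext fun v => by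
    simp only [LinearMap.comp_apply, LinearMap.smul_apply, LinearMap.id_apply]
    rw [hf, map_sum, hM.T_smul_apply, hA]
    simp only [map_nsmul, hg]
    exact (sum_vecMul_smul _ _ _).symm
  have hfg : f ∘ₗ g = (T l : ℤ[T;T⁻¹]) • LinearMap.id := hN.hom_ext fun v => by
    simp only [LinearMap.comp_apply, LinearMap.smul_apply, LinearMap.id_apply]
    rw [hg, map_sum, hN.T_smul_apply, hB]
    simp only [map_nsmul, hf]
    exact (sum_vecMul_smul _ _ _).symm
  have hTT : ((T (-l) : ℤ[T;T⁻¹]) * T l) = 1 := by rw [← LaurentPolynomial.T_add]; simp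
  refine ⟨LinearEquiv.ofLinearMap f ((T (-l) : ℤ[T;T⁻¹]) • g) ?_ ?_,
    fun z => ⟨fun hz => ?_, fun hz => ?_⟩⟩
  · rw [LinearMap.comp_smul, hfg, smul_smul, hTT, one_smul]
  · rw [LinearMap.smul_comp, hgf, smul_smul, hTT, one_smul]
  · have h := hM.T_smul_mem (-l) (hN.map_mem g (fun w => by
      rw [hg]; exact hM.sum_mem_cone _) (fun k z => hM.T_smul_mem k) hz)
    have h' : g (f z) = (T l : ℤ[T;T⁻¹]) • z := DFunLike.congr_fun hgf z
    change (T (-l) : ℤ[T;T⁻¹]) • g (f z) ∈ C at h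
    rwa [h', smul_smul, hTT, one_smul] at h
  · exact hM.map_mem f (fun w => by
      rw [hf]; exact hN.sum_mem_cone _) (fun k z => hN.T_smul_mem k) hz

/-- Each `f (x v)` lies in the cone, hence is a natural combination of the `y w` up to a power of
`T`; surplus powers of `T` are absorbed as powers of `B` to reach a common exponent. -/
theorem exists_matrix (f : M →ₗ[ℤ[T;T⁻¹]] N) (hf : ∀ z ∈ C, f z ∈ D) :
    ∃ (n : ℕ) (R : Matrix V W ℕ), A * R = R * B ∧
      ∀ v, (T n : ℤ[T;T⁻¹]) • f (x v) = ∑ w, R v w • y w := by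
  have h₁ : ∀ v, ∃ (n : ℕ) (r : W → ℕ), (T n : ℤ[T;T⁻¹]) • f (x v) = ∑ w, r w • y w := fun v => by
    obtain ⟨k, r, hr⟩ := (hN.mem_iff _).1 (hf (x v) (by
      simpa [Pi.single_apply] using hM.sum_mem_cone (Pi.single v 1)))
    refine ⟨(-k).toNat, Matrix.vecMul r (B ^ k.toNat), ?_⟩
    rw [hr, smul_smul, ← LaurentPolynomial.T_add, ← hN.T_smul_sum]
    congr 2
    omega
  choose n r hr using h₁
  have h₂ : ∀ v, (T (∑ u, n u : ℕ) : ℤ[T;T⁻¹]) • f (x v) =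
      ∑ w, Matrix.vecMul (r v) (B ^ (∑ u ∈ Finset.univ.erase v, n u)) w • y w := fun v => by
    rw [← Finset.sum_erase_add _ _ (Finset.mem_univ v), Nat.cast_add, LaurentPolynomial.T_add,
      mul_smul, hr, hN.T_smul_sum]
  generalize (∑ u, n u) = N₀ at h₂
  let R : Matrix V W ℕ := Matrix.of fun v =>
    Matrix.vecMul (r v) (B ^ (∑ u ∈ Finset.univ.erase v, n u))
  have hR : ∀ v, (T N₀ : ℤ[T;T⁻¹]) • f (x v) = ∑ w, R v w • y w := h₂
  -- Row `v` of either matrix represents `T (N₀ + 1) • f (x v)`. The matrices themselves agree only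
  -- after multiplication by `B ^ k`, so `R` is then replaced by `R * B ^ k`.
  obtain ⟨k, hk⟩ := hN.exists_pow_matrix (A * R) (R * B) fun v => by
    have e₁ : ∑ w, (A * R) v w • y w = ∑ u, A v u • ∑ w, R u w • y w :=
      sum_vecMul_smul (A v) R y
    have e₂ : ∑ w, (R * B) v w • y w = ∑ u, R v u • ∑ w, B u w • y w :=
      sum_vecMul_smul (R v) B y
    simp only [← hN.T_smul] at e₂
    simp only [← hR] at e₁
    rw [e₁, e₂]
    simp only [smul_comm _ (T 1 : ℤ[T;T⁻¹]), ← Finset.smul_sum]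
    rw [← hR]
    simp only [smul_comm _ (T N₀ : ℤ[T;T⁻¹]), ← Finset.smul_sum]
    rw [← map_smul, hM.T_smul, map_sum]
    simp only [map_nsmul]
  refine ⟨N₀ + k, R * B ^ k, ?_, fun v => ?_⟩
  · rw [← Matrix.mul_assoc, hk k le_rfl, Matrix.mul_assoc, Matrix.mul_assoc, ← pow_succ', pow_succ]
  · rw [Nat.cast_add, add_comm, LaurentPolynomial.T_add, mul_smul, hR, hN.T_smul_sum]
    rfl

-- Row `v` of `R * S` represents `T (n + m) • g (f (x v))`, which is also represented by row `v` of
-- `A ^ (n + m)`.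
omit hN [DecidableEq W] in
theorem exists_mul_mul_pow {f : M →ₗ[ℤ[T;T⁻¹]] N} {g : N →ₗ[ℤ[T;T⁻¹]] M} (hgf : ∀ z, g (f z) = z)
    {n m : ℕ} {R : Matrix V W ℕ} {S : Matrix W V ℕ}
    (hR : ∀ v, (T n : ℤ[T;T⁻¹]) • f (x v) = ∑ w, R v w • y w)
    (hS : ∀ w, (T m : ℤ[T;T⁻¹]) • g (y w) = ∑ v, S w v • x v) :
    ∃ k : ℕ, ∀ j, k ≤ j → R * S * A ^ j = A ^ (n + m + j) := by
  obtain ⟨k, hk⟩ := hM.exists_pow_matrix (R * S) (A ^ (n + m)) fun v => by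
    have e₁ : ∑ u, (R * S) v u • x u = ∑ w, R v w • ∑ u, S w u • x u :=
      sum_vecMul_smul (R v) S x
    rw [e₁, ← hM.T_smul_apply, Nat.cast_add, LaurentPolynomial.T_add, mul_smul, smul_comm]
    conv_rhs => rw [← hgf (x v), ← map_smul, hR, map_sum, Finset.smul_sum]
    refine Finset.sum_congr rfl fun w _ => ?_
    rw [← hS, map_nsmul, smul_comm]
  exact ⟨k, fun j hj => by rw [hk j hj, ← pow_add]⟩

theorem shiftEquivalent_of_equiv (f : M ≃ₗ[ℤ[T;T⁻¹]] N) (hf : ∀ z, f z ∈ D ↔ z ∈ C) :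
    Matrix.ShiftEquivalent A B := by
  obtain ⟨n, R, hR, hfR⟩ := hM.exists_matrix hN f.toLinearMap fun z hz => (hf z).2 hz
  obtain ⟨m, S, hS, hfS⟩ := hN.exists_matrix hM f.symm.toLinearMap fun z hz =>
    (hf _).1 (by simpa using hz)
  obtain ⟨k, hk⟩ := hM.exists_mul_mul_pow (f := f.toLinearMap) (g := f.symm.toLinearMap)
    (fun z => by simp) hfR hfS
  obtain ⟨k', hk'⟩ := hN.exists_mul_mul_pow (f := f.symm.toLinearMap) (g := f.toLinearMap)
    (fun z => by simp) hfS hfR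
  have h := hk (k + k' + 1) (by omega)
  have h' := hk' (k + k' + 1) (by omega)
  -- The exponent exceeds both bounds, and the summand `1` makes the lag positive. The second
  -- equation uses `A ^ j * R = R * B ^ j`.
  refine ⟨n + m + (k + k' + 1), R, S * A ^ (k + k' + 1), by omega, ?_, ?_, hR, ?_⟩
  · rw [← h, Matrix.mul_assoc]
  · rw [Matrix.mul_assoc, pow_mul_eq_mul_pow hR, ← Matrix.mul_assoc, h', add_comm n m]
  · rw [← Matrix.mul_assoc B, hS, Matrix.mul_assoc, Matrix.mul_assoc, ← pow_succ, pow_succ']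

end IsDimensionModule

end DimensionModule

/-! ### A representation showing that vertices are nonzero -/

namespace DirectedGraph

section Representation

variable {V E : Type*} (G : DirectedGraph V E) (K : Type*) [Field K]

/-- In a finite graph without sinks, countably infinite sets at the vertices split along the
edges. -/
theorem exists_branching [Fintype E] (hG : G.NoSinks) :
    ∃ Ψ : V × ℕ ≃ E × ℕ, ∀ x, G.s (Ψ x).1 = x.1 := by
  have h : ∀ v, Nonempty (ℕ ≃ {e // G.s e = v} × ℕ) := fun v => by
    obtain ⟨e, he⟩ := hG v
    have : Nonempty {e // G.s e = v} := ⟨⟨e, he⟩⟩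
    -- A nonempty finite set of edges times `ℕ` is countably infinite.
    exact nonempty_equiv_of_countable
  let Ψ : V × ℕ → E × ℕ := fun x => (((h x.1).some x.2).1, ((h x.1).some x.2).2)
  have hΨ : ∀ x, G.s (Ψ x).1 = x.1 := fun x => ((h x.1).some x.2).1.2
  refine ⟨Equiv.ofBijective Ψ ⟨?_, ?_⟩, hΨ⟩
  · rintro ⟨v, n⟩ ⟨w, m⟩ hxy
    have hvw : v = w := by
      have := hΨ (v, n)
      rw [hxy] at this
      exact this.symm.trans (hΨ (w, m))
    subst hvw
    have h1 : ((h v).some n) = (h v).some m :=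
      Prod.ext (Subtype.ext (congrArg Prod.fst hxy)) (congrArg Prod.snd hxy :)
    rw [(h v).some.injective h1]
  · rintro ⟨e, m⟩
    refine ⟨(G.s e, (h (G.s e)).some.symm (⟨e, rfl⟩, m)), ?_⟩
    simp [Ψ]

variable {G} (Ψ : V × ℕ ≃ E × ℕ) [DecidableEq V] [DecidableEq E]

/-- The action of the generators on functions on the branching set. -/
def branchingAction : Gen V E → Module.End K (V × ℕ → K)
  | .vertex v =>
    { toFun := fun h x => if x.1 = v then h x else 0
      map_add' := fun h k => by ext x; simp only [Pi.add_apply]; split_ifs <;> simp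
      map_smul' := fun c h => by ext x; simp }
  | .edge e =>
    { toFun := fun h x => if (Ψ x).1 = e then h (G.r e, (Ψ x).2) else 0
      map_add' := fun h k => by ext x; simp only [Pi.add_apply]; split_ifs <;> simp
      map_smul' := fun c h => by ext x; simp }
  | .ghost e =>
    { toFun := fun h x => if x.1 = G.r e then h (Ψ.symm (e, x.2)) else 0
      map_add' := fun h k => by ext x; simp only [Pi.add_apply]; split_ifs <;> simp
      map_smul' := fun c h => by ext x; simp }

theorem branchingAction_vertex (v : V) (h : V × ℕ → K) (x : V × ℕ) :
    branchingAction (G := G) K Ψ (.vertex v) h x = if x.1 = v then h x else 0 := rfl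

theorem branchingAction_edge (e : E) (h : V × ℕ → K) (x : V × ℕ) :
    branchingAction (G := G) K Ψ (.edge e) h x =
      if (Ψ x).1 = e then h (G.r e, (Ψ x).2) else 0 := rfl

theorem branchingAction_ghost (e : E) (h : V × ℕ → K) (x : V × ℕ) :
    branchingAction (G := G) K Ψ (.ghost e) h x =
      if x.1 = G.r e then h (Ψ.symm (e, x.2)) else 0 := rfl

variable [Fintype V] [Fintype E]

/-- The set `V × ℕ` imitates a space of infinite paths: `x` has first edge `e = (Ψ x).1` and tail
`(r(e), (Ψ x).2)`. An edge acts by pulling back along removal of that first edge, a ghost edge along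
prefixing it; every point having exactly one first edge gives `∑ e e* = v`. -/
theorem branchingAction_rel (hΨ : ∀ x, G.s (Ψ x).1 = x.1) {a b : FreeAlgebra K (Gen V E)}
    (h : G.LeavittRel K a b) : FreeAlgebra.lift K (branchingAction (G := G) K Ψ) a =
      FreeAlgebra.lift K (branchingAction (G := G) K Ψ) b := by
  have hΨ' : ∀ y, (Ψ.symm y).1 = G.s y.1 := fun y => by
    rw [← hΨ, Equiv.apply_symm_apply]
  refine LinearMap.ext fun k => funext fun x => ?_
  cases h <;>
    simp only [map_sum, map_mul, map_one, map_zero, FreeAlgebra.lift_ι_apply, Module.End.mul_apply,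
      LinearMap.sum_apply, Finset.sum_apply, Module.End.one_apply, LinearMap.zero_apply,
      Pi.zero_apply, branchingAction_vertex, branchingAction_edge, branchingAction_ghost]
  case one => simp
  case vertex_idem => split_ifs <;> rfl
  case vertex_orthogonal v w hvw =>
    split_ifs with h1 h2
    · exact absurd (h1.symm.trans h2) hvw
    · rfl
    · rfl
  case s_edge e =>
    split_ifs with h1 h2 h2
    · rfl
    · rfl
    · exact absurd (by rw [← hΨ, h2]) h1
    · rfl
  case edge_r => simp
  case r_ghost => split_ifs <;> rfl
  case ghost_s e => simp [hΨ']
  case ghost_edge e =>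
    simp only [Equiv.apply_symm_apply, if_true]
    split_ifs with h1
    · rw [← h1]
    · rfl
  case ghost_edge_ne e f hef => simp [hef]
  case sum_edge_ghost v hv =>
    rw [Finset.sum_filter]
    rw [Finset.sum_eq_single (Ψ x).1]
    · simp [hΨ]
    · intro e _ he
      simp [he.symm]
    · simp

end Representation

section Family

variable {V : Type u} {E : Type v} [Fintype V] [Fintype E] [DecidableEq V] [DecidableEq E]
  (G : DirectedGraph V E) (K : Type w) [Field K]

theorem gen_vertex_ne_zero (hG : G.NoSinks) (v : V) : G.gen K (.vertex v) ≠ 0 := by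
  obtain ⟨Ψ, hΨ⟩ := G.exists_branching hG
  let ρ : G.LeavittPathAlgebra K →ₐ[K] Module.End K (V × ℕ → K) :=
    RingQuot.liftAlgHom K ⟨FreeAlgebra.lift K (branchingAction (G := G) K Ψ),
      fun _ _ h => branchingAction_rel K Ψ hΨ h⟩
  intro h
  have h1 : ρ (G.gen K (.vertex v)) = branchingAction (G := G) K Ψ (.vertex v) := by
    rw [gen, RingQuot.liftAlgHom_mkAlgHom_apply, FreeAlgebra.lift_ι_apply]
  rw [h, map_zero] at h1
  -- The vertex fixes the value `1` of the constant function at a point over `v`.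
  have := congrFun (DFunLike.congr_fun h1 fun _ => (1 : K)) (v, 0)
  rw [branchingAction_vertex] at this
  simp at this

/-- The canonical family of generators of the Leavitt path algebra. -/
noncomputable def leavittFamily (hG : G.NoSinks) : LeavittFamily G (G.leavittGrading K) where
  vtx v := G.gen K (.vertex v)
  edge e := G.gen K (.edge e)
  ghost e := G.gen K (.ghost e)
  sum_vtx := by simpa [gen] using G.gen_rel K .one
  vtx_mul_vtx v w := by
    split_ifs with h
    · subst h
      simpa [gen] using G.gen_rel K (.vertex_idem v)
    · simpa [gen] using G.gen_rel K (.vertex_orthogonal v w h)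
  s_edge e := by simpa [gen] using G.gen_rel K (.s_edge e)
  edge_r e := by simpa [gen] using G.gen_rel K (.edge_r e)
  r_ghost e := by simpa [gen] using G.gen_rel K (.r_ghost e)
  ghost_s e := by simpa [gen] using G.gen_rel K (.ghost_s e)
  ghost_edge e f := by
    split_ifs with h
    · subst h
      simpa [gen] using G.gen_rel K (.ghost_edge e)
    · simpa [gen] using G.gen_rel K (.ghost_edge_ne e f h)
  sum_edge_ghost v := by
    rw [← Finset.sum_subtype (Finset.univ.filter fun e => G.s e = v) (by simp)
      fun e => G.gen K (.edge e) * G.gen K (.ghost e)]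
    simpa [gen] using G.gen_rel K (.sum_edge_ghost v (hG v))
  vtx_mem v := G.gen_mem K (.vertex v)
  edge_mem e := G.gen_mem K (.edge e)
  ghost_mem e := G.gen_mem K (.ghost e)
  vtx_ne_zero := G.gen_vertex_ne_zero K hG
  mem_span x hx := by
    refine Submodule.span_mono ?_ hx
    rintro _ ⟨l, hl, rfl⟩
    refine ⟨l, hl, congrArg List.prod (List.map_congr_left fun g _ => ?_)⟩
    cases g <;> rfl

end Family

end DirectedGraph

/-! ### The graded Grothendieck group as a dimension module, and the conclusion -/

theorem LeavittFamily.isDimensionModule {K : Type*} [Field K] {V E : Type*} [Fintype V]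
    [Fintype E] [DecidableEq V] [DecidableEq E] {G : DirectedGraph V E} {L : Type u} [Ring L]
    [Algebra K L] {𝒜 : ℤ → Submodule K L} [GradedAlgebra 𝒜] (Λ : LeavittFamily G 𝒜) :
    IsDimensionModule G.adjMatrix (AddMonoidHom.mrange (K0gr.of 𝒜)) Λ.vtxClass where
  T_smul := Λ.T_smul_vtxClass
  mem_iff _ := Λ.mem_mrange_of_iff
  exists_pow _ _ h := Λ.exists_vecMul_pow_eq_of_sum_eq h
  exists_sub y := by
    obtain ⟨⟨a, b⟩, h⟩ := (AddLocalization.addMonoidOf (⊤ : AddSubmonoid (Vgr 𝒜))).surj y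
    exact ⟨_, ⟨a, rfl⟩, _, ⟨b, rfl⟩, eq_sub_of_add_eq h⟩

theorem K0gr.le_iff {A : Type u} [Ring A] {σ : Type v} [SetLike σ A] {𝒜 : ℤ → σ} {x y : K0gr 𝒜} :
    x ≤ y ↔ y - x ∈ AddMonoidHom.mrange (K0gr.of 𝒜) := Iff.rfl

theorem corollaryh99 {K : Type*} [Field K]
    {V₁ E₁ : Type*} [Fintype V₁] [Fintype E₁] [DecidableEq V₁]
    {V₂ E₂ : Type*} [Fintype V₂] [Fintype E₂] [DecidableEq V₂]
    (E : DirectedGraph V₁ E₁) (F : DirectedGraph V₂ E₂) (hE : E.NoSinks) (hF : F.NoSinks) :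
    Matrix.ShiftEquivalent E.adjMatrix F.adjMatrix ↔
      ∃ φ : K0gr (E.leavittGrading K) ≃ₗ[ℤ[T;T⁻¹]] K0gr (F.leavittGrading K),
        ∀ x y, φ x ≤ φ y ↔ x ≤ y := by
  classical
  have h₁ := (E.leavittFamily K hE).isDimensionModule
  have h₂ := (F.leavittFamily K hF).isDimensionModule
  constructor
  · intro h
    obtain ⟨φ, hφ⟩ := h₁.exists_equiv_of_shiftEquivalent h₂ h
    refine ⟨φ, fun x y => ?_⟩
    rw [K0gr.le_iff, K0gr.le_iff, ← map_sub, hφ]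
  · rintro ⟨φ, hφ⟩
    refine h₁.shiftEquivalent_of_equiv h₂ φ fun z => ?_
    have := hφ 0 z
    rwa [map_zero, K0gr.le_iff, K0gr.le_iff, sub_zero, sub_zero] at this
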